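/- For integers $n\ge 0$ and $0\le k,x\le n$ let $$\mathrm{kr}^{(n)}_k(x)=\binom nk^{-1}\sum_{j=0}^k(-1)^j\binom xj\binom{n-x}{k-j}$$ be the normalised Krawtchouk polynomial. Call $c\in(0,1)$ a Krawtchouk constant if $|\mathrm{kr}^{(n)}_k(x)|\le e^{-ckx/n}$ for all integers $n\ge 1$ and $0\le k,x\le n/2$. For $q\ge1$, positive integers $d,N$ and $\xi\in\mathbb T^d=(\mathbb R/\mathbb Z)^d$ put $\kappa=\kappa_q(d,N)=N/d^{1/q}$, $$B=\Big\{x\in\mathbb Z^d:\ \sum_{i=1}^d|x_i|^q\le N^q\Big\},\qquad m_N^q(\xi)=\frac1{|B|}\sum_{x\in B}e^{2\pi i\,x\cdot\xi},$$ $$\|\xi\|=\Big(\sum_{j=1}^d\sin^2(\pi\xi_j)\Big)^{1/2},\qquad \|\xi+1/2\|=\Big(\sum_{j=1}^d\cos^2(\pi\xi_j)\Big)^{1/2}.$$ **Proposition 3.5.** Krawtchouk constants exist, and there is an absolute constant $C>0$ such that for all real $q\ge1$, all positive integers $d,N$ with $\kappa_q(d,N)\le e^{-12/q}$ and all $\xi\in\mathbb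 T^d$ the following hold. 1. For every Krawtchouk constant $c$, $$|m_N^q(\xi)|\le C\Big(\exp\Big(-\frac{c\,\kappa^q}{320}\min\big(\|\xi\|^2,\|\xi+1/2\|^2\big)\Big)+\frac1{N^q}\Big).$$ 2. If $\|\xi\|\le\|\xi+1/2\|$, then $$|m_N^q(\xi)-1|\le C\Big(\kappa^q\|\xi\|^2+\frac1{N^q}+\kappa^{q/50}\Big).$$ 3. If $\|\xi\|>\|\xi+1/2\|$, then $$\Big|m_N^q(\xi)-\frac1{|B|}\sum_{x\in B}(-1)^{\sum_{i=1}^dx_i}\Big|\le C\Big(\kappa^q\|\xi+1/2\|^2+\frac1{N^q}+\kappa^{q/50}\Big).$$ -/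

import Mathlib

namespace LqBall

/-- The closed `ℓ^q` ball `B_t^q` of radius `t` centred at the origin of `ℝ^d`. -/
def ball (q : ℝ) (d : ℕ) (t : ℝ) : Set (Fin d → ℝ) :=
  {x | ∑ i, |x i| ^ q ≤ t ^ q}

/-- The lattice points of the ball, `B_t^q ∩ ℤ^d`. -/
def latticeBall (q : ℝ) (d : ℕ) (t : ℝ) : Set (Fin d → ℤ) :=
  {x | (fun i => (x i : ℝ)) ∈ ball q d t}

/-- The lattice ball is finite, so that the cardinality and the finite sums below
have their usual meaning. -/
theorem latticeBall_finite {q : ℝ} (hq : 1 ≤ q) (d : ℕ) {t : ℝ} (ht : 0 ≤ t) :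
    (latticeBall q d t).Finite := by
  have hq0 : 0 < q := by linarith
  refine (Set.Finite.pi' (fun _ : Fin d => Set.finite_Icc (-⌈t⌉) ⌈t⌉)).subset ?_
  intro x hx i
  have h1 : |(x i : ℝ)| ^ q ≤ t ^ q :=
    le_trans (Finset.single_le_sum (f := fun i => |(x i : ℝ)| ^ q)
      (fun j _ => Real.rpow_nonneg (abs_nonneg _) q) (Finset.mem_univ i)) hx
  have h2 : |(x i : ℝ)| ≤ t := (Real.rpow_le_rpow_iff (abs_nonneg _) ht hq0).1 h1
  have h3 : |(x i : ℝ)| ≤ (⌈t⌉ : ℝ) := h2.trans (Int.le_ceil t)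
  have h4 : |x i| ≤ ⌈t⌉ := by exact_mod_cast h3
  exact Set.mem_Icc.2 (abs_le.1 h4)

/-- `e(s) = exp(2πis)`. -/
noncomputable def e (s : ℝ) : ℂ :=
  Complex.exp (2 * Real.pi * Complex.I * s)

/-- The average of `f` over `B_t^q ∩ ℤ^d`. -/
noncomputable def average (q : ℝ) (d : ℕ) (t : ℝ) (f : (Fin d → ℤ) → ℂ) : ℂ :=
  (1 / ((latticeBall q d t).ncard : ℂ)) * ∑ᶠ x ∈ latticeBall q d t, f x

/-- The multiplier symbol `m_t^q(ξ)`: the average of `e(x · ξ)` over `B_t^q ∩ ℤ^d`. -/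
noncomputable def multiplier (q : ℝ) (d : ℕ) (t : ℝ) (ξ : Fin d → ℝ) : ℂ :=
  average q d t fun x => e (∑ i, (x i : ℝ) * ξ i)

/-- The average of `(-1)^{x_1 + ⋯ + x_d}` over `B_t^q ∩ ℤ^d`. -/
noncomputable def signedAverage (q : ℝ) (d : ℕ) (t : ℝ) : ℂ :=
  average q d t fun x => (-1 : ℂ) ^ (∑ i, x i)

/-- `‖ξ‖ = (∑_j sin²(πξ_j))^{1/2}`, a 1-periodic function of each coordinate. -/
noncomputable def torusNorm {d : ℕ} (ξ : Fin d → ℝ) : ℝ :=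
  Real.sqrt (∑ j, Real.sin (Real.pi * ξ j) ^ 2)

/-- The translate `ξ + 1/2 = (ξ_1 + 1/2, …, ξ_d + 1/2)`. -/
noncomputable def halfShift {d : ℕ} (ξ : Fin d → ℝ) : Fin d → ℝ :=
  fun j => ξ j + 1 / 2

/-- `κ_q(d, N) = N / d^{1/q}`. -/
noncomputable def kappa (q : ℝ) (d N : ℕ) : ℝ :=
  (N : ℝ) / (d : ℝ) ^ (1 / q)

/-- The value at an integer `0 ≤ x ≤ n` of the normalised Krawtchouk polynomial
of index `0 ≤ k ≤ n`. -/
noncomputable def krawtchouk (n k x : ℕ) : ℝ :=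
  (1 / (n.choose k : ℝ)) *
    ∑ j ∈ Finset.range (k + 1),
      (-1 : ℝ) ^ j * (x.choose j : ℝ) * ((n - x).choose (k - j) : ℝ)

/-- `c ∈ (0, 1)` is an admissible constant in the uniform bound for Krawtchouk polynomials:
`|kr_k^{(n)}(x)| ≤ exp(-ckx/n)` for all `n` and all integers `0 ≤ x, k ≤ n/2`. -/
def IsKrawtchoukConstant (c : ℝ) : Prop :=
  0 < c ∧ c < 1 ∧ ∀ n k x : ℕ, 2 * k ≤ n → 2 * x ≤ n →
    |krawtchouk n k x| ≤ Real.exp (-(c * k * x / n))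

end LqBall

/-! Write `L = N ^ q`, so that `κ ^ q = L / d`, and note that the hypothesis on `κ` says `L ≤ e⁻¹²
d`. The ball is invariant under sign changes and permutations of coordinates. Averaging over signs
replaces `e(x · ξ)` by `∏ cos(2π x_i ξ_i)`.

Low frequencies. The deviation `1 - ∏ cos(2π x_i ξ_i)` is at most `2 ∑ x_i² sin²(π ξ_i)` in absolute
value. Moving one unit of mass from a positive coordinate to a zero coordinate keeps a point in the
ball, and double counting these moves gives the second moment bound `E x_j² ≤ 32 L / d`
(`sum_sq_coord_le`). This yields part 2. Part 3 is the same estimate at `ξ + 1/2`, with the sign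
`(-1) ^ ∑ x_i` as a weight.

Decay. Points with at most `L / 80` coordinates equal to `±1` form a proportion at most `2 / L` of
the ball, by an exponential-moment count (`card_filter_ones_le`). The other points are sorted by the
number `n` of coordinates of modulus at most one and the number `k` of modulus one. Within such a
class, permutations make the set of unit coordinates a uniform `k`-subset of the set of small
coordinates, which is itself a uniform `n`-subset. The unit coordinates contribute factors `1 - 2
sin²(π ξ_i)`. Each factor is the mean of a random sign, so the average over `k`-subsets is a mean of
Krawtchouk values, to which the Krawtchouk bound applies (`abs_sum_level_le`).

Krawtchouk constants. The constant `1 / 16` is obtained by iterating a two-step recursion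
(`krawtchoukCoeff_rec`) in which every step gains a fixed factor. -/

namespace LqBall

/-! ### Krawtchouk polynomials and the existence of a Krawtchouk constant -/

open Polynomial in
/-- The polynomial `(1 - X)^a (1 + X)^b`, whose coefficients are the unnormalised
Krawtchouk polynomials. -/
noncomputable def krawtchoukGen (a b : ℕ) : ℝ[X] := (1 - X) ^ a * (1 + X) ^ b

/-- The normalised Krawtchouk value of index `k` at `a` in dimension `a + b`. -/
noncomputable def krawtchoukCoeff (a b k : ℕ) : ℝ :=
  (krawtchoukGen a b).coeff k / ((a + b).choose k : ℝ)

open Polynomial in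
theorem coeff_one_sub_X_pow (a j : ℕ) :
    ((1 - X : ℝ[X]) ^ a).coeff j = (-1) ^ j * (a.choose j : ℝ) := by
  have h : (1 - X : ℝ[X]) ^ a = ((1 + X : ℝ[X]) ^ a).comp (C (-1) * X) := by
    simp [sub_eq_add_neg]
  rw [h, comp_C_mul_X_coeff, coeff_one_add_X_pow, mul_comm]

theorem krawtchoukGen_coeff (a b k : ℕ) :
    (krawtchoukGen a b).coeff k =
      ∑ j ∈ Finset.range (k + 1), (-1 : ℝ) ^ j * (a.choose j : ℝ) * (b.choose (k - j) : ℝ) := by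
  rw [krawtchoukGen, Polynomial.coeff_mul, Finset.Nat.sum_antidiagonal_eq_sum_range_succ_mk]
  refine Finset.sum_congr rfl fun j _ => ?_
  rw [coeff_one_sub_X_pow, Polynomial.coeff_one_add_X_pow]

theorem krawtchouk_eq_coeff {n k x : ℕ} (hx : x ≤ n) :
    krawtchouk n k x = krawtchoukCoeff x (n - x) k := by
  rw [krawtchouk, krawtchoukCoeff, krawtchoukGen_coeff, Nat.add_sub_cancel' hx]
  ring

theorem abs_krawtchoukCoeff_le_one (a b k : ℕ) : |krawtchoukCoeff a b k| ≤ 1 := by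
  rw [krawtchoukCoeff, abs_div, Nat.abs_cast]
  refine div_le_one_of_le₀ ?_ (Nat.cast_nonneg _)
  rw [krawtchoukGen_coeff, Nat.add_choose_eq,
    Finset.Nat.sum_antidiagonal_eq_sum_range_succ_mk]
  push_cast
  refine (Finset.abs_sum_le_sum_abs _ _).trans (Finset.sum_le_sum fun j _ => ?_)
  simp [abs_mul]

theorem krawtchoukCoeff_comm (a b k : ℕ) :
    krawtchoukCoeff b a k = (-1) ^ k * krawtchoukCoeff a b k := by
  have h : krawtchoukGen b a =
      (krawtchoukGen a b).comp (Polynomial.C (-1) * Polynomial.X) := by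
    simp [krawtchoukGen, sub_eq_add_neg, mul_comm]
  rw [krawtchoukCoeff, krawtchoukCoeff, h, Polynomial.comp_C_mul_X_coeff, add_comm b a]
  ring

open Polynomial in
theorem krawtchoukGen_ode (a b : ℕ) :
    C ((a : ℝ) + b - 1) * derivative (krawtchoukGen a b)
        - X * derivative (derivative (krawtchoukGen a b)) =
      C ((b : ℝ) * (b - 1)) * krawtchoukGen a (b - 2)
        - C ((a : ℝ) * (a - 1)) * krawtchoukGen (a - 2) b := by
  unfold krawtchoukGen
  -- The cases 0, 1 and at least 2 are separated because `a - 2` and `b - 2` truncate; the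
  -- coefficients `a(a-1)` and `b(b-1)` vanish whenever truncation occurs.
  rcases a with _ | _ | a <;> rcases b with _ | _ | b <;>
    simp [derivative_pow, map_add, map_mul, map_sub, map_natCast] <;> ring

theorem krawtchoukGen_coeff_rec (a b k : ℕ) :
    ((k : ℝ) + 1) * ((a : ℝ) + b - (k + 1)) * (krawtchoukGen a b).coeff (k + 1) =
      (b : ℝ) * (b - 1) * (krawtchoukGen a (b - 2)).coeff k
        - (a : ℝ) * (a - 1) * (krawtchoukGen (a - 2) b).coeff k := by
  have h := congrArg (fun p => Polynomial.coeff p k) (krawtchoukGen_ode a b)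
  simp only [Polynomial.coeff_sub, Polynomial.coeff_C_mul, Polynomial.coeff_derivative] at h
  rw [← h]
  rcases k with _ | k
  · simp
  · simp only [Polynomial.coeff_X_mul, Polynomial.coeff_derivative]
    push_cast
    ring

/-- Probabilistically: `krawtchoukCoeff a b k` is the mean of `(-1) ^ |I ∩ T|` over `k`-subsets `I`
of `a + b` points, with `|T| = a`. Select a random ordered pair with its first point in `I` and its
second outside, and average over swapping the two. The contribution cancels unless both points lie
on the same side of `T`, and the sign is `+` outside `T` and `-` inside. -/
theorem krawtchoukCoeff_rec {a b k : ℕ} (hk : k + 2 ≤ a + b) :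
    ((a : ℝ) + b) * (a + b - 1) * krawtchoukCoeff a b (k + 1) =
      (b : ℝ) * (b - 1) * krawtchoukCoeff a (b - 2) k
        - (a : ℝ) * (a - 1) * krawtchoukCoeff (a - 2) b k := by
  obtain ⟨n, hn⟩ : ∃ n, a + b = n + 2 := ⟨a + b - 2, by omega⟩
  have hkn : k ≤ n := by omega
  have hnR : (a : ℝ) + b = n + 2 := by exact_mod_cast hn
  have hkR : (k : ℝ) ≤ n := by exact_mod_cast hkn
  have hc1 : ((n + 2).choose (k + 1) : ℝ) * ((k + 1) * (n - k + 1)) =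
      (n + 2) * (n + 1) * n.choose k := by
    have e1 := Nat.add_one_mul_choose_eq (n + 1) k
    have e2 := Nat.choose_mul_succ_eq n k
    have e1' : ((n : ℝ) + 1 + 1) * ((n + 1).choose k : ℝ) =
        ((n + 1 + 1).choose (k + 1) : ℝ) * (k + 1) := by exact_mod_cast e1
    have e2' : (n.choose k : ℝ) * (n + 1) = ((n + 1).choose k : ℝ) * (n + 1 - k) := by
      have : (n.choose k : ℝ) * (n + 1) = ((n + 1).choose k : ℝ) * ((n + 1 - k : ℕ) : ℝ) := by
        exact_mod_cast e2
      rwa [Nat.cast_sub (by omega), Nat.cast_add_one] at this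
    rw [show n + 2 = n + 1 + 1 from rfl]
    linear_combination (-(n - k + 1 : ℝ)) * e1' - ((n : ℝ) + 2) * e2'
  have hpos : (0 : ℝ) < n.choose k := by exact_mod_cast Nat.choose_pos hkn
  have hpos' : (0 : ℝ) < (n + 2).choose (k + 1) := by
    exact_mod_cast Nat.choose_pos (by omega)
  have hrec := krawtchoukGen_coeff_rec a b k
  have hb : (b : ℝ) * (b - 1) * krawtchoukCoeff a (b - 2) k =
      (b : ℝ) * (b - 1) * (krawtchoukGen a (b - 2)).coeff k / n.choose k := by
    rcases b with _ | _ | b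
    · simp
    · simp
    · rw [krawtchoukCoeff, show a + (b + 1 + 1 - 2) = n by omega]; ring
  have ha : (a : ℝ) * (a - 1) * krawtchoukCoeff (a - 2) b k =
      (a : ℝ) * (a - 1) * (krawtchoukGen (a - 2) b).coeff k / n.choose k := by
    rcases a with _ | _ | a
    · simp
    · simp
    · rw [krawtchoukCoeff, show a + 1 + 1 - 2 + b = n by omega]; ring
  rw [hb, ha, ← sub_div, ← hrec, krawtchoukCoeff, hn, hnR]
  rw [← mul_div_assoc, div_eq_div_iff hpos'.ne' hpos.ne']
  linear_combination (-(krawtchoukGen a b).coeff (k + 1)) * hc1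

/-- Each use of the recursion costs the factor `(a(a-1) + b(b-1)) / (n(n-1)) = 1 - 2ab / (n(n-1))`,
where `n = a + b`. The hypotheses keep `a ≥ A`, `b ≥ D` and `n ≤ M` at each of the `m` uses; the `+
2` is there because the last use happens after only `m - 1` reductions. -/
theorem abs_krawtchoukCoeff_le_pow {A D M : ℝ} (hA : 0 ≤ A) (hD : 0 ≤ D) (m : ℕ) :
    ∀ a b k : ℕ, m ≤ k → m + k ≤ a + b → A + 2 * m ≤ a + 2 → D + 2 * m ≤ b + 2 →
      ((a : ℝ) + b) ≤ M → |krawtchoukCoeff a b k| ≤ (1 - 2 * A * D / M ^ 2) ^ m := by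
  induction m with
  | zero => intro a b k _ _ _ _ _; simpa using abs_krawtchoukCoeff_le_one a b k
  | succ m ih =>
    intro a b k hk hkn hAa hDb hM
    obtain ⟨k, rfl⟩ : ∃ k', k = k' + 1 := ⟨k - 1, by omega⟩
    push_cast at hAa hDb
    set r := 1 - 2 * A * D / M ^ 2 with hr
    have hn2 : (2 : ℝ) ≤ (a : ℝ) + b := by exact_mod_cast (by omega : 2 ≤ a + b)
    have hm0 : (0 : ℝ) ≤ m := m.cast_nonneg
    have h1 : |(b : ℝ) * (b - 1) * krawtchoukCoeff a (b - 2) k| ≤ (b : ℝ) * (b - 1) * r ^ m := by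
      rcases b with _ | _ | b
      · simp
      · simp
      · have h := ih a b k (by omega) (by omega) (by linarith) (by push_cast at hDb; linarith)
          (by push_cast at hM; linarith)
        rw [abs_mul, abs_of_nonneg (by push_cast; ring_nf; positivity)]
        exact mul_le_mul_of_nonneg_left h (by push_cast; ring_nf; positivity)
    have h2 : |(a : ℝ) * (a - 1) * krawtchoukCoeff (a - 2) b k| ≤ (a : ℝ) * (a - 1) * r ^ m := by
      rcases a with _ | _ | a
      · simp
      · simp
      · have h := ih a b k (by omega) (by omega) (by push_cast at hAa; linarith) (by linarith)
          (by push_cast at hM; linarith)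
        rw [abs_mul, abs_of_nonneg (by push_cast; ring_nf; positivity)]
        exact mul_le_mul_of_nonneg_left h (by push_cast; ring_nf; positivity)
    have hpos : 0 < ((a : ℝ) + b) * (a + b - 1) := mul_pos (by linarith) (by linarith)
    have hMpos : 0 < M ^ 2 := by have : 0 < M := by linarith
                                 positivity
    have hfrac : (b : ℝ) * (b - 1) + a * (a - 1) ≤ r * (((a : ℝ) + b) * (a + b - 1)) := by
      have hAD : A * D ≤ (a : ℝ) * b :=
        mul_le_mul (by linarith) (by linarith) hD (Nat.cast_nonneg _)
      have hle : ((a : ℝ) + b) * (a + b - 1) ≤ M ^ 2 := by nlinarith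
      have : 2 * A * D / M ^ 2 * (((a : ℝ) + b) * (a + b - 1)) ≤ 2 * (a * b) := by
        rw [div_mul_eq_mul_div, div_le_iff₀ hMpos]
        have h0 : 0 ≤ A * D := mul_nonneg hA hD
        nlinarith
      rw [hr, sub_mul, one_mul]
      nlinarith
    have hsum0 : 0 ≤ (b : ℝ) * (b - 1) + a * (a - 1) := by
      have : ∀ c : ℕ, (0 : ℝ) ≤ (c : ℝ) * (c - 1) := by
        intro c
        rcases c with _ | c
        · simp
        · push_cast; ring_nf; positivity
      exact add_nonneg (this b) (this a)
    have hr0 : 0 ≤ r := by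
      by_contra hneg
      push Not at hneg
      nlinarith [mul_neg_of_neg_of_pos hneg hpos]
    have hrec := krawtchoukCoeff_rec (a := a) (b := b) (k := k) (by omega)
    have habs : ((a : ℝ) + b) * (a + b - 1) * |krawtchoukCoeff a b (k + 1)| ≤
        ((a : ℝ) + b) * (a + b - 1) * r ^ (m + 1) := by
      calc ((a : ℝ) + b) * (a + b - 1) * |krawtchoukCoeff a b (k + 1)|
          = |((a : ℝ) + b) * (a + b - 1) * krawtchoukCoeff a b (k + 1)| := by
            rw [abs_mul, abs_of_pos hpos]
        _ ≤ (b : ℝ) * (b - 1) * r ^ m + (a : ℝ) * (a - 1) * r ^ m := by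
            rw [hrec]; exact (abs_sub _ _).trans (add_le_add h1 h2)
        _ = ((b : ℝ) * (b - 1) + a * (a - 1)) * r ^ m := by ring
        _ ≤ r * (((a : ℝ) + b) * (a + b - 1)) * r ^ m :=
            mul_le_mul_of_nonneg_right hfrac (pow_nonneg hr0 m)
        _ = _ := by ring
    exact le_of_mul_le_mul_left habs hpos

theorem choose_mul_choose_sub_comm (n a b : ℕ) :
    n.choose a * (n - a).choose b = n.choose b * (n - b).choose a := by
  by_cases h : a + b ≤ n
  · have h1 := Nat.choose_mul (n := n) (k := a + b) (s := a) (by omega)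
    have h2 := Nat.choose_mul (n := n) (k := a + b) (s := b) (by omega)
    rw [Nat.add_sub_cancel_left] at h1
    rw [Nat.add_sub_cancel] at h2
    rw [← h1, ← h2, Nat.choose_symm_add]
  · rcases Nat.lt_or_ge n a with ha | ha
    · rw [Nat.choose_eq_zero_of_lt ha, Nat.choose_eq_zero_of_lt (by omega : n - b < a)]; simp
    · rw [Nat.choose_eq_zero_of_lt (by omega : n - a < b)]
      rcases Nat.lt_or_ge n b with hb | hb
      · rw [Nat.choose_eq_zero_of_lt hb]; simp
      · rw [Nat.choose_eq_zero_of_lt (by omega : n - b < a)]; simp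

theorem choose_mul_choose_mul_choose_comm {n k x j : ℕ} (hjk : j ≤ k) (hjx : j ≤ x) :
    n.choose x * (x.choose j * (n - x).choose (k - j)) =
      n.choose k * (k.choose j * (n - k).choose (x - j)) := by
  rw [← mul_assoc, ← mul_assoc, Nat.choose_mul hjx, Nat.choose_mul hjk, mul_assoc, mul_assoc]
  have h := choose_mul_choose_sub_comm (n - j) (x - j) (k - j)
  rw [show n - j - (x - j) = n - x by omega, show n - j - (k - j) = n - k by omega] at h
  rw [h]

theorem krawtchouk_symm {n k x : ℕ} (hk : k ≤ n) (hx : x ≤ n) :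
    krawtchouk n k x = krawtchouk n x k := by
  have hk0 : (n.choose k : ℝ) ≠ 0 := by exact_mod_cast (Nat.choose_pos hk).ne'
  have hx0 : (n.choose x : ℝ) ≠ 0 := by exact_mod_cast (Nat.choose_pos hx).ne'
  have extend : ∀ a b : ℕ, ∑ j ∈ Finset.range (a + 1),
      (-1 : ℝ) ^ j * (b.choose j : ℝ) * ((n - b).choose (a - j) : ℝ) =
      ∑ j ∈ Finset.range (min a b + 1),
      (-1 : ℝ) ^ j * (b.choose j : ℝ) * ((n - b).choose (a - j) : ℝ) := by
    intro a b
    symm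
    refine Finset.sum_subset (fun j hj => ?_) (fun j hj hj' => ?_)
    · simp only [Finset.mem_range] at *; omega
    · simp only [Finset.mem_range] at *
      rw [Nat.choose_eq_zero_of_lt (by omega : b < j)]; simp
  rw [krawtchouk, krawtchouk, extend k x, extend x k, min_comm x k, one_div, one_div,
    inv_mul_eq_iff_eq_mul₀ hk0, ← mul_assoc, mul_comm _ (n.choose x : ℝ)⁻¹, mul_assoc,
    eq_inv_mul_iff_mul_eq₀ hx0, Finset.mul_sum, Finset.mul_sum]
  refine Finset.sum_congr rfl fun j hj => ?_
  simp only [Finset.mem_range] at hj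
  have h : (n.choose x : ℝ) * (x.choose j * (n - x).choose (k - j)) =
      n.choose k * (k.choose j * (n - k).choose (x - j)) := by
    exact_mod_cast choose_mul_choose_mul_choose_comm (by omega : j ≤ k) (by omega : j ≤ x)
  linear_combination (-1 : ℝ) ^ j * h

theorem abs_krawtchouk_le_of_le {n k x : ℕ} (hx : 2 * x ≤ n) (hkx : k ≤ x) :
    |krawtchouk n k x| ≤ Real.exp (-(1 / 16 * k * x / n)) := by
  rcases Nat.eq_zero_or_pos k with rfl | hk0
  · simpa [krawtchouk_eq_coeff (by omega : x ≤ n)] using abs_krawtchoukCoeff_le_one x (n - x) 0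
  rw [krawtchouk_eq_coeff (by omega)]
  -- Here `m = ⌈k/4⌉`: since `k ≤ x ≤ n/2`, removing `2m` points from either side leaves `a ≥ x/2`
  -- and `b ≥ n/4` throughout, so each step gains `1 - x/(4n)`.
  obtain ⟨m, hm1, hm2⟩ : ∃ m : ℕ, k ≤ 4 * m ∧ 4 * m ≤ k + 3 := ⟨(k + 3) / 4, by omega, by omega⟩
  have hxR : 2 * (x : ℝ) ≤ n := by exact_mod_cast hx
  have hkxR : (k : ℝ) ≤ x := by exact_mod_cast hkx
  have hkR : (1 : ℝ) ≤ k := by exact_mod_cast hk0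
  have hm1R : (k : ℝ) ≤ 4 * m := by exact_mod_cast hm1
  have hm2R : 4 * (m : ℝ) ≤ k + 3 := by exact_mod_cast hm2
  have hsub : ((n - x : ℕ) : ℝ) = n - x := by rw [Nat.cast_sub (by omega)]
  have hn0 : (0 : ℝ) < n := by linarith
  have h := abs_krawtchoukCoeff_le_pow (A := (x : ℝ) / 2) (D := (n : ℝ) / 4) (M := n)
    (by positivity) (by positivity) m x (n - x) k (by omega) (by omega) (by linarith)
    (by rw [hsub]; linarith) (by rw [hsub]; linarith)
  refine h.trans ?_
  have hr : 1 - 2 * ((x : ℝ) / 2) * ((n : ℝ) / 4) / (n : ℝ) ^ 2 = 1 - x / (4 * n) := by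
    field_simp
  rw [hr]
  have hr0 : 0 ≤ 1 - (x : ℝ) / (4 * n) := by
    rw [sub_nonneg, div_le_one (by positivity)]; linarith
  calc (1 - (x : ℝ) / (4 * n)) ^ m ≤ Real.exp (-((x : ℝ) / (4 * n))) ^ m :=
        pow_le_pow_left₀ hr0 (by linarith [Real.add_one_le_exp (-((x : ℝ) / (4 * n)))]) m
    _ = Real.exp (-(m * ((x : ℝ) / (4 * n)))) := by rw [← Real.exp_nat_mul]; ring_nf
    _ ≤ _ := by
      rw [Real.exp_le_exp, neg_le_neg_iff]
      rw [show (1 / 16 * (k : ℝ) * x / n) = k / 4 * (x / (4 * n)) by field_simp; ring]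
      exact mul_le_mul_of_nonneg_right (by linarith) (by positivity)

theorem isKrawtchoukConstant_one_div_sixteen : IsKrawtchoukConstant (1 / 16) := by
  refine ⟨by norm_num, by norm_num, fun n k x hk hx => ?_⟩
  rcases le_total k x with h | h
  · exact abs_krawtchouk_le_of_le hx h
  · rw [krawtchouk_symm (by omega) (by omega)]
    refine (abs_krawtchouk_le_of_le hk h).trans_eq ?_
    ring_nf

/-- The reflection `a ↔ b` changes the value only by a sign, so one may assume that the argument is
at most half the dimension. The sum of two exponentials covers both cases at once. -/
theorem IsKrawtchoukConstant.abs_coeff_le {c : ℝ} (hc : IsKrawtchoukConstant c) {a b k : ℕ}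
    (hk : 2 * k ≤ a + b) :
    |krawtchoukCoeff a b k| ≤ Real.exp (-(c * k / (a + b : ℕ) * a)) +
      Real.exp (-(c * k / (a + b : ℕ) * b)) := by
  have key : ∀ a b : ℕ, 2 * k ≤ a + b → a ≤ b →
      |krawtchoukCoeff a b k| ≤ Real.exp (-(c * k / (a + b : ℕ) * a)) := by
    intro a b hk hab
    have h := hc.2.2 (a + b) k a hk (by omega)
    rw [krawtchouk_eq_coeff (by omega), Nat.add_sub_cancel_left] at h
    refine h.trans_eq ?_
    congr 2
    ring
  rcases le_total a b with h | h
  · exact (key a b hk h).trans (le_add_of_nonneg_right (Real.exp_pos _).le)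
  · have := key b a (by omega) h
    rw [krawtchoukCoeff_comm, abs_mul, abs_pow, abs_neg, abs_one, one_pow, one_mul,
      add_comm b a] at this
    exact this.trans (le_add_of_nonneg_left (Real.exp_pos _).le)

/-! ### Averages of products over random subsets -/

/-- Let `T` contain each `i` independently with probability `p i`; then each factor is the mean of
`β` to the indicator of `i ∈ T`. It is used with `β = -1` to produce Krawtchouk values and with `β =
0` to produce the probability that `T` misses `I`. -/
theorem sum_powersetCard_prod_polarize {ι : Type*} [DecidableEq ι] (V : Finset ι) (k : ℕ)
    (p : ι → ℝ) (β : ℝ) :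
    ∑ I ∈ V.powersetCard k, ∏ i ∈ I, (p i * β + (1 - p i)) =
      ∑ T ∈ V.powerset, ((∏ i ∈ T, p i) * ∏ i ∈ V \ T, (1 - p i)) *
        ∑ I ∈ V.powersetCard k, β ^ (I ∩ T).card := by
  have h : ∀ I ∈ V.powersetCard k, ∏ i ∈ I, (p i * β + (1 - p i)) =
      ∑ T ∈ V.powerset, ((∏ i ∈ T, p i) * ∏ i ∈ V \ T, (1 - p i)) * β ^ (I ∩ T).card := by
    intro I hI
    have hIV := (Finset.mem_powersetCard.1 hI).1
    calc ∏ i ∈ I, (p i * β + (1 - p i))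
        = ∏ i ∈ V, (p i * (if i ∈ I then β else 1) + (1 - p i)) := by
          rw [← Finset.prod_subset hIV]
          · exact Finset.prod_congr rfl fun i hi => by rw [if_pos hi]
          · intro i _ hi; rw [if_neg hi]; ring
      _ = _ := by
          rw [Finset.prod_add]
          refine Finset.sum_congr rfl fun T _ => ?_
          rw [Finset.prod_mul_distrib, Finset.prod_ite, Finset.prod_const, Finset.prod_const_one,
            Finset.filter_mem_eq_inter, Finset.inter_comm]
          ring
  rw [Finset.sum_congr rfl h, Finset.sum_comm]
  exact Finset.sum_congr rfl fun T _ => by rw [Finset.mul_sum]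

open Polynomial in
theorem sum_powersetCard_pow_card_inter {ι : Type*} [DecidableEq ι] {V T : Finset ι}
    (hT : T ⊆ V) (k : ℕ) (β : ℝ) :
    ∑ I ∈ V.powersetCard k, β ^ (I ∩ T).card =
      ((1 + C β * X : ℝ[X]) ^ T.card * (1 + X) ^ (V \ T).card).coeff k := by
  have h1 : (1 + C β * X : ℝ[X]) ^ T.card * (1 + X) ^ (V \ T).card =
      ∏ i ∈ V, (1 + C (if i ∈ T then β else 1) * X) := by
    rw [← Finset.prod_sdiff hT, mul_comm, ← Finset.prod_const, ← Finset.prod_const]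
    congr 1
    · exact Finset.prod_congr rfl fun i hi => by
        rw [if_neg (Finset.mem_sdiff.1 hi).2]; simp
    · exact Finset.prod_congr rfl fun i hi => by rw [if_pos hi]
  rw [h1, Finset.prod_one_add, finsetSum_coeff, Finset.powersetCard_eq_filter]
  rw [Finset.sum_filter]
  refine Finset.sum_congr rfl fun I _ => ?_
  rw [Finset.prod_mul_distrib, Finset.prod_const, ← map_prod, coeff_C_mul_X_pow, Finset.prod_ite,
    Finset.prod_const, Finset.prod_const_one, mul_one, Finset.filter_mem_eq_inter]
  simp only [eq_comm]

theorem prod_mul_add_one_sub_eq_sum {ι : Type*} [DecidableEq ι] (V : Finset ι)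
    (p : ι → ℝ) (r : ℝ) :
    ∑ T ∈ V.powerset, ((∏ i ∈ T, p i) * ∏ i ∈ V \ T, (1 - p i)) * r ^ T.card =
      ∏ i ∈ V, (1 - p i * (1 - r)) := by
  calc _ = ∏ i ∈ V, (p i * r + (1 - p i)) := by
        rw [Finset.prod_add]
        refine Finset.sum_congr rfl fun T _ => ?_
        rw [Finset.prod_mul_distrib, Finset.prod_const]; ring
    _ = _ := Finset.prod_congr rfl fun i _ => by ring

theorem weight_nonneg {ι : Type*} [DecidableEq ι] {V T : Finset ι} {p : ι → ℝ}
    (hp0 : ∀ i, 0 ≤ p i) (hp1 : ∀ i, p i ≤ 1) :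
    0 ≤ (∏ i ∈ T, p i) * ∏ i ∈ V \ T, (1 - p i) :=
  mul_nonneg (Finset.prod_nonneg fun i _ => hp0 i)
    (Finset.prod_nonneg fun i _ => sub_nonneg.2 (hp1 i))

theorem IsKrawtchoukConstant.abs_sum_powersetCard_le {c : ℝ} (hc : IsKrawtchoukConstant c)
    {ι : Type*} [DecidableEq ι] (V : Finset ι) {k : ℕ} (hk : 2 * k ≤ V.card) {p : ι → ℝ}
    (hp0 : ∀ i, 0 ≤ p i) (hp1 : ∀ i, p i ≤ 1) :
    |∑ I ∈ V.powersetCard k, ∏ i ∈ I, (1 - 2 * p i)| ≤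
      (V.card.choose k : ℝ) *
        (∏ i ∈ V, (1 - p i * (1 - Real.exp (-(c * k / V.card)))) +
          ∏ i ∈ V, (1 - (1 - p i) * (1 - Real.exp (-(c * k / V.card))))) := by
  set r := Real.exp (-(c * k / V.card)) with hr
  have hpol := sum_powersetCard_prod_polarize V k p (-1)
  have e1 : ∀ i, p i * (-1) + (1 - p i) = 1 - 2 * p i := fun i => by ring
  simp only [e1] at hpol
  rw [hpol]
  have hinner : ∀ T ∈ V.powerset, |∑ I ∈ V.powersetCard k, (-1 : ℝ) ^ (I ∩ T).card| ≤
      V.card.choose k * (r ^ T.card + r ^ (V \ T).card) := by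
    intro T hT
    rw [Finset.mem_powerset] at hT
    have hcard : T.card + (V \ T).card = V.card := by
      rw [add_comm]; exact Finset.card_sdiff_add_card_eq_card hT
    have h := hc.abs_coeff_le (a := T.card) (b := (V \ T).card) (k := k) (by omega)
    rw [hcard, krawtchoukCoeff, abs_div, Nat.abs_cast, hcard, div_le_iff₀'
      (by exact_mod_cast Nat.choose_pos (by omega))] at h
    rw [sum_powersetCard_pow_card_inter hT]
    have e2 : (1 + Polynomial.C (-1 : ℝ) * Polynomial.X) = 1 - Polynomial.X := by
      simp [sub_eq_add_neg]
    rw [e2]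
    refine h.trans_eq ?_
    rw [hr, ← Real.exp_nat_mul, ← Real.exp_nat_mul]
    ring_nf
  calc _ ≤ ∑ T ∈ V.powerset, ((∏ i ∈ T, p i) * ∏ i ∈ V \ T, (1 - p i)) *
          (V.card.choose k * (r ^ T.card + r ^ (V \ T).card)) := by
        refine (Finset.abs_sum_le_sum_abs _ _).trans (Finset.sum_le_sum fun T hT => ?_)
        rw [abs_mul, abs_of_nonneg (weight_nonneg hp0 hp1)]
        exact mul_le_mul_of_nonneg_left (hinner T hT) (weight_nonneg hp0 hp1)
    _ = _ := by
        rw [← prod_mul_add_one_sub_eq_sum, ← prod_mul_add_one_sub_eq_sum V fun i => 1 - p i,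
          mul_add, Finset.mul_sum, Finset.mul_sum]
        -- Complementation `T ↦ V \ T` exchanges the probabilities `p` and `1 - p`.
        have hflip : ∑ T ∈ V.powerset, (V.card.choose k : ℝ) *
            (((∏ i ∈ T, (1 - p i)) * ∏ i ∈ V \ T, (1 - (1 - p i))) * r ^ T.card) =
            ∑ T ∈ V.powerset, (V.card.choose k : ℝ) *
            (((∏ i ∈ T, p i) * ∏ i ∈ V \ T, (1 - p i)) * r ^ (V \ T).card) := by
          refine Finset.sum_bij' (fun T _ => V \ T) (fun T _ => V \ T) ?_ ?_ ?_ ?_ ?_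
          · intro T _; simp
          · intro T _; simp
          · intro T hT; simpa using hT
          · intro T hT; simpa using hT
          · intro T hT
            simp only [Finset.mem_powerset] at hT
            simp only [Finset.sdiff_sdiff_eq_self hT, sub_sub_cancel]
            ring
        rw [hflip, ← Finset.sum_add_distrib]
        exact Finset.sum_congr rfl fun T _ => by ring

/-- An `n`-subset with `n ≥ d / 2` avoids a given `t`-set with probability at most `2⁻ᵗ`: by
Pascal's rule, removing one point at least halves the binomial coefficient. -/
theorem two_pow_mul_choose_sub_le {d n t : ℕ} (hd : d ≤ 2 * n) (hn : 1 ≤ n) (ht : t ≤ d) :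
    2 ^ t * (d - t).choose n ≤ d.choose n := by
  induction t with
  | zero => simp
  | succ t ih =>
    refine le_trans ?_ (ih (by omega))
    obtain ⟨m, hm⟩ : ∃ m, d - t = m + 1 := ⟨d - t - 1, by omega⟩
    obtain ⟨n, rfl⟩ : ∃ n', n = n' + 1 := ⟨n - 1, by omega⟩
    rw [show d - (t + 1) = m by omega, hm, Nat.choose_succ_succ, pow_succ]
    have : m.choose (n + 1) ≤ m.choose n := by
      have h := Nat.choose_succ_right_eq m n
      have h2 : m.choose n * (m - n) ≤ m.choose n * (n + 1) :=
        Nat.mul_le_mul_left _ (by omega)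
      exact Nat.le_of_mul_le_mul_right (h.trans_le h2) (by omega)
    nlinarith [Nat.pos_of_ne_zero (pow_ne_zero t (two_ne_zero (α := ℕ)))]

theorem sum_powersetCard_prod_one_sub_le {ι : Type*} [DecidableEq ι] (V : Finset ι) {n : ℕ}
    (hn : V.card ≤ 2 * n) {u : ι → ℝ} (hu0 : ∀ i, 0 ≤ u i) (hu1 : ∀ i, u i ≤ 1) :
    ∑ U ∈ V.powersetCard n, ∏ i ∈ U, (1 - u i) ≤
      (V.card.choose n : ℝ) * ∏ i ∈ V, (1 - u i / 2) := by
  rcases Nat.eq_zero_or_pos n with rfl | hn1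
  · have : V = ∅ := Finset.card_eq_zero.1 (by omega)
    subst this
    simp
  have hpol := sum_powersetCard_prod_polarize V n u 0
  have e1 : ∀ i, u i * 0 + (1 - u i) = 1 - u i := fun i => by ring
  simp only [e1] at hpol
  have e2 := prod_mul_add_one_sub_eq_sum V u (1 / 2)
  have e3 : ∀ i, 1 - u i * (1 - 1 / 2) = 1 - u i / 2 := fun i => by ring
  simp only [e3] at e2
  rw [hpol, ← e2, Finset.mul_sum]
  refine Finset.sum_le_sum fun T hT => ?_
  rw [Finset.mem_powerset] at hT
  rw [mul_left_comm]
  refine mul_le_mul_of_nonneg_left ?_ (weight_nonneg hu0 hu1)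
  rw [sum_powersetCard_pow_card_inter hT]
  simp only [map_zero, zero_mul, add_zero, one_pow, one_mul, Polynomial.coeff_one_add_X_pow]
  rw [Finset.card_sdiff_of_subset hT, one_div, inv_pow, ← div_eq_mul_inv,
    le_div_iff₀ (by positivity), mul_comm]
  exact_mod_cast two_pow_mul_choose_sub_le hn hn1 (Finset.card_le_card hT)

theorem half_le_one_sub_exp_neg {a : ℝ} (h0 : 0 ≤ a) (h1 : a ≤ 1) :
    a / 2 ≤ 1 - Real.exp (-a) := by
  have h := Real.add_one_le_exp a
  have h2 : Real.exp (-a) * Real.exp a = 1 := by rw [← Real.exp_add]; simp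
  have h3 := Real.exp_pos (-a)
  have h4 : Real.exp (-a) * (1 + a) ≤ 1 := by nlinarith
  nlinarith

/-- The factor `1 / 4` combines `1 - e⁻ᵃ ≥ a / 2` with the halving of `u` caused by averaging over
`U`. -/
theorem sum_powersetCard_prod_le_exp {ι : Type*} [DecidableEq ι] (V : Finset ι) {n : ℕ}
    (hn : V.card ≤ 2 * n) {p : ι → ℝ} (hp0 : ∀ i, 0 ≤ p i) (hp1 : ∀ i, p i ≤ 1)
    {a : ℝ} (ha0 : 0 ≤ a) (ha1 : a ≤ 1) :
    ∑ U ∈ V.powersetCard n, ∏ i ∈ U, (1 - p i * (1 - Real.exp (-a))) ≤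
      (V.card.choose n : ℝ) * Real.exp (-(a / 4 * ∑ i ∈ V, p i)) := by
  have hb := half_le_one_sub_exp_neg ha0 ha1
  have hb1 : 1 - Real.exp (-a) ≤ 1 := by linarith [Real.exp_pos (-a)]
  have hb0 : 0 ≤ 1 - Real.exp (-a) := by linarith
  have hu1 : ∀ i, p i * (1 - Real.exp (-a)) ≤ 1 := fun i => mul_le_one₀ (hp1 i) hb0 hb1
  refine (sum_powersetCard_prod_one_sub_le V hn (fun i => mul_nonneg (hp0 i) hb0) hu1).trans ?_
  refine mul_le_mul_of_nonneg_left ?_ (Nat.cast_nonneg _)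
  rw [Finset.mul_sum, ← Finset.sum_neg_distrib, Real.exp_sum]
  refine Finset.prod_le_prod (fun i _ => by linarith [hu1 i]) fun i _ => ?_
  refine le_trans ?_ (Real.add_one_le_exp _)
  nlinarith [hp0 i]

theorem IsKrawtchoukConstant.sum_abs_sum_powersetCard_le {c : ℝ} (hc : IsKrawtchoukConstant c)
    {ι : Type*} [DecidableEq ι] (V : Finset ι) {n k : ℕ} (hn : V.card ≤ 2 * n)
    (hk : 2 * k ≤ n) {p : ι → ℝ} (hp0 : ∀ i, 0 ≤ p i) (hp1 : ∀ i, p i ≤ 1) :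
    ∑ U ∈ V.powersetCard n, |∑ I ∈ U.powersetCard k, ∏ i ∈ I, (1 - 2 * p i)| ≤
      (V.card.choose n : ℝ) * (n.choose k) *
        (Real.exp (-(c * k / n / 4 * ∑ i ∈ V, p i)) +
          Real.exp (-(c * k / n / 4 * ∑ i ∈ V, (1 - p i)))) := by
  have ha0 : 0 ≤ c * k / n := div_nonneg (mul_nonneg hc.1.le (Nat.cast_nonneg _))
    (Nat.cast_nonneg _)
  have ha1 : c * k / n ≤ 1 := by
    refine div_le_one_of_le₀ ?_ (Nat.cast_nonneg _)
    have hkn : (k : ℝ) ≤ n := by exact_mod_cast (by omega : k ≤ n)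
    nlinarith [hc.1, hc.2.1, (Nat.cast_nonneg k : (0 : ℝ) ≤ k)]
  have h1 := sum_powersetCard_prod_le_exp V hn hp0 hp1 ha0 ha1
  have h2 := sum_powersetCard_prod_le_exp V hn (p := fun i => 1 - p i)
    (fun i => sub_nonneg.2 (hp1 i)) (fun i => by linarith [hp0 i]) ha0 ha1
  calc _ ≤ ∑ U ∈ V.powersetCard n, (n.choose k : ℝ) *
        (∏ i ∈ U, (1 - p i * (1 - Real.exp (-(c * k / n)))) +
          ∏ i ∈ U, (1 - (1 - p i) * (1 - Real.exp (-(c * k / n))))) := by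
        refine Finset.sum_le_sum fun U hU => ?_
        have hU' := (Finset.mem_powersetCard.1 hU).2
        have h := hc.abs_sum_powersetCard_le U (k := k) (by omega) hp0 hp1
        rwa [hU'] at h
    _ ≤ _ := by
        rw [← Finset.mul_sum, Finset.sum_add_distrib, mul_comm (V.card.choose n : ℝ), mul_assoc]
        refine mul_le_mul_of_nonneg_left ?_ (Nat.cast_nonneg _)
        rw [mul_add]
        exact add_le_add h1 h2

/-! ### Sign and permutation invariance of the ball -/

section Symmetry

variable {d : ℕ} {q L : ℝ} {B : Finset (Fin d → ℤ)}

theorem sum_units_mul (hB : ∀ x, x ∈ B ↔ ∑ i, |(x i : ℝ)| ^ q ≤ L) {M : Type*}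
    [AddCommMonoid M] (g : (Fin d → ℤ) → M) (ε : Fin d → ℤˣ) :
    ∑ x ∈ B, g (fun i => ε i * x i) = ∑ x ∈ B, g x := by
  have hmem : ∀ x ∈ B, (fun i => (ε i : ℤ) * x i) ∈ B := by
    intro x hx
    rw [hB] at hx ⊢
    refine (Finset.sum_congr rfl fun i _ => ?_).trans_le hx
    rcases Int.units_eq_one_or (ε i) with h | h <;> simp [h]
  have hinv : ∀ x : Fin d → ℤ, (fun i => (ε i : ℤ) * ((ε i : ℤ) * x i)) = x := by
    intro x
    funext i
    rcases Int.units_eq_one_or (ε i) with h | h <;> simp [h]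
  exact Finset.sum_bij' (fun x _ i => (ε i : ℤ) * x i) (fun x _ i => (ε i : ℤ) * x i)
    hmem hmem (fun x _ => hinv x) (fun x _ => hinv x) (fun x _ => rfl)

theorem sum_comp_perm (hB : ∀ x, x ∈ B ↔ ∑ i, |(x i : ℝ)| ^ q ≤ L) {M : Type*}
    [AddCommMonoid M] (g : (Fin d → ℤ) → M) (σ : Equiv.Perm (Fin d)) :
    ∑ x ∈ B, g (x ∘ σ) = ∑ x ∈ B, g x := by
  have hmem : ∀ (τ : Equiv.Perm (Fin d)), ∀ x ∈ B, x ∘ τ ∈ B := by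
    intro τ x hx
    rw [hB] at hx ⊢
    exact (Equiv.sum_comp τ fun i => |(x i : ℝ)| ^ q).trans_le hx
  refine Finset.sum_bij' (fun x _ => x ∘ σ) (fun x _ => x ∘ σ.symm)
    (hmem σ) (hmem σ.symm) (fun x _ => ?_) (fun x _ => ?_) (fun x _ => rfl)
  · funext i; simp
  · funext i; simp

theorem e_sum (s : Fin d → ℝ) : e (∑ i, s i) = ∏ i, e (s i) := by
  simp only [e, ← Complex.exp_sum, Complex.ofReal_sum, Finset.mul_sum]

theorem e_add_e_neg (s : ℝ) : e s + e (-s) = 2 * (Real.cos (2 * Real.pi * s) : ℂ) := by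
  simp only [e]
  push_cast
  rw [Complex.two_cos]
  congr 2 <;> ring

/-- Average over all `2 ^ d` sign vectors. The weight `s` is there to accommodate the parity sign
needed near `ξ = 1/2`. -/
theorem sum_mul_e_eq_sum_mul_prod_cos (hB : ∀ x, x ∈ B ↔ ∑ i, |(x i : ℝ)| ^ q ≤ L)
    {s : (Fin d → ℤ) → ℂ} (hs : ∀ (ε : Fin d → ℤˣ) x, s (fun i => ε i * x i) = s x)
    (ξ : Fin d → ℝ) :
    ∑ x ∈ B, s x * e (∑ i, (x i : ℝ) * ξ i) =
      ∑ x ∈ B, s x * ((∏ i, Real.cos (2 * Real.pi * (x i * ξ i)) : ℝ) : ℂ) := by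
  have h2 : (2 : ℂ) ^ d ≠ 0 := pow_ne_zero _ two_ne_zero
  refine mul_left_cancel₀ h2 ?_
  have hcard : ∑ _ε : Fin d → ℤˣ, (1 : ℂ) = 2 ^ d := by simp
  calc (2 : ℂ) ^ d * ∑ x ∈ B, s x * e (∑ i, (x i : ℝ) * ξ i)
      = ∑ ε : Fin d → ℤˣ, ∑ x ∈ B, s x * ∏ i, e ((ε i : ℤ) * x i * ξ i) := by
        rw [← hcard, Finset.sum_mul]
        refine Finset.sum_congr rfl fun ε _ => ?_
        rw [one_mul, ← sum_units_mul hB _ ε]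
        refine Finset.sum_congr rfl fun x _ => ?_
        rw [hs, e_sum]
        push_cast
        rfl
    _ = ∑ x ∈ B, s x * ∑ ε : Fin d → ℤˣ, ∏ i, e ((ε i : ℤ) * x i * ξ i) := by
        rw [Finset.sum_comm]
        exact Finset.sum_congr rfl fun x _ => by rw [Finset.mul_sum]
    _ = _ := by
        rw [Finset.mul_sum]
        refine Finset.sum_congr rfl fun x _ => ?_
        have h := Finset.prod_univ_sum (fun _ : Fin d => (Finset.univ : Finset ℤˣ))
          (fun i u => e ((u : ℤ) * x i * ξ i))
        rw [Fintype.piFinset_univ] at h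
        rw [← h, mul_left_comm]
        congr 1
        have hi : ∀ i, ∑ u : ℤˣ, e ((u : ℤ) * x i * ξ i) =
            2 * (Real.cos (2 * Real.pi * (x i * ξ i)) : ℂ) := by
          intro i
          rw [← e_add_e_neg, UnitsInt.univ, Finset.sum_pair (by decide)]
          simp
        rw [Finset.prod_congr rfl fun i _ => hi i, Finset.prod_mul_distrib]
        simp

end Symmetry

/-! ### Elementary inequalities for cosine products -/

section Elementary

theorem abs_one_sub_prod_le {ι : Type*} (s : Finset ι) {a : ι → ℝ} (ha : ∀ i, |a i| ≤ 1) :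
    |1 - ∏ i ∈ s, a i| ≤ ∑ i ∈ s, (1 - a i) := by
  classical
  induction s using Finset.induction_on with
  | empty => simp
  | insert i s hi ih =>
    rw [Finset.prod_insert hi, Finset.sum_insert hi]
    have h : 1 - a i * ∏ j ∈ s, a j = (1 - a i) + a i * (1 - ∏ j ∈ s, a j) := by ring
    rw [h]
    refine (abs_add_le _ _).trans (add_le_add ?_ ?_)
    · rw [abs_of_nonneg (by linarith [(abs_le.1 (ha i)).2])]
    · rw [abs_mul]
      exact (mul_le_of_le_one_left (abs_nonneg _) (ha i)).trans ih

theorem abs_sin_nat_mul_le (n : ℕ) (θ : ℝ) : |Real.sin (n * θ)| ≤ n * |Real.sin θ| := by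
  induction n with
  | zero => simp
  | succ n ih =>
    push_cast
    rw [add_mul, one_mul, Real.sin_add, add_mul, one_mul]
    refine (abs_add_le _ _).trans (add_le_add ?_ ?_)
    · rw [abs_mul]
      exact (mul_le_of_le_one_right (abs_nonneg _) (Real.abs_cos_le_one _)).trans ih
    · rw [abs_mul]
      exact mul_le_of_le_one_left (abs_nonneg _) (Real.abs_cos_le_one _)

theorem sin_int_mul_sq_le (m : ℤ) (θ : ℝ) :
    Real.sin (m * θ) ^ 2 ≤ (m : ℝ) ^ 2 * Real.sin θ ^ 2 := by
  rw [← mul_pow]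
  refine sq_le_sq.2 ?_
  rw [abs_mul]
  obtain ⟨n, rfl | rfl⟩ := Int.eq_nat_or_neg m
  · simpa using abs_sin_nat_mul_le n θ
  · simpa using abs_sin_nat_mul_le n θ

theorem one_sub_cos_le (m : ℤ) (ξ : ℝ) :
    1 - Real.cos (2 * Real.pi * (m * ξ)) ≤ 2 * ((m : ℝ) ^ 2 * Real.sin (Real.pi * ξ) ^ 2) := by
  have h := sin_int_mul_sq_le m (Real.pi * ξ)
  have h2 := Real.cos_two_mul ((m : ℝ) * (Real.pi * ξ))
  have h3 := Real.sin_sq_add_cos_sq ((m : ℝ) * (Real.pi * ξ))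
  rw [show 2 * Real.pi * (m * ξ) = 2 * ((m : ℝ) * (Real.pi * ξ)) by ring]
  linarith

end Elementary

/-! ### Second moment of a coordinate -/

section Moment

variable {d : ℕ} {q L : ℝ} {B : Finset (Fin d → ℤ)}

theorem one_le_abs_rpow (hq : 1 ≤ q) {m : ℤ} (hm : m ≠ 0) : 1 ≤ |(m : ℝ)| ^ q := by
  refine Real.one_le_rpow ?_ (by linarith)
  exact_mod_cast Int.one_le_abs hm

theorem card_ne_zero_le (hq : 1 ≤ q) {x : Fin d → ℤ} (hx : ∑ i, |(x i : ℝ)| ^ q ≤ L) :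
    ((Finset.univ.filter fun i => x i ≠ 0).card : ℝ) ≤ L := by
  refine le_trans ?_ hx
  rw [Finset.card_filter, Nat.cast_sum]
  refine Finset.sum_le_sum fun i _ => ?_
  split_ifs with h
  · simpa using one_le_abs_rpow hq h
  · simpa using Real.rpow_nonneg (abs_nonneg _) q

/-- Superadditivity of `t ↦ t ^ q` gives `(x j - 1) ^ q + 1 ≤ (x j) ^ q`. -/
theorem mem_of_transfer (hq : 1 ≤ q) (hB : ∀ x, x ∈ B ↔ ∑ i, |(x i : ℝ)| ^ q ≤ L)
    {x : Fin d → ℤ} (hx : x ∈ B) {i j : Fin d} (hj : 0 < x j) (hi : x i = 0) :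
    Function.update (Function.update x j (x j - 1)) i 1 ∈ B := by
  rw [hB] at hx ⊢
  have hij : i ≠ j := by rintro rfl; omega
  set y := Function.update (Function.update x j (x j - 1)) i 1 with hy
  refine le_trans ?_ hx
  rw [← sub_nonpos, ← Finset.sum_sub_distrib, Fintype.sum_eq_add i j hij]
  · have h1 : y i = 1 := by simp [hy]
    have h2 : y j = x j - 1 := by simp [hy, hij.symm]
    have h3 : (1 : ℝ) ≤ x j := by exact_mod_cast hj
    have h4 := Real.add_rpow_le_rpow_add (a := (x j : ℝ) - 1) (b := 1) (by linarith) zero_le_one hq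
    rw [h1, h2, hi]
    push_cast
    rw [abs_of_nonneg (by linarith : 0 ≤ (x j : ℝ) - 1), abs_of_nonneg (by linarith : 0 ≤ (x j : ℝ)),
      abs_zero, abs_one, Real.zero_rpow (by linarith)]
    rw [sub_add_cancel] at h4
    simp only [Real.one_rpow] at h4 ⊢
    linarith
  · rintro l ⟨h1, h2⟩
    simp [hy, h1, h2]

/-- Double counting of transfers. Every source point has at least `d - L` zero coordinates to
receive a unit. Given the receiving index, the transfer is injective, and that index is one of at
most `L` nonzero coordinates of the image. -/
theorem sum_sq_pos_coord_le (hq : 1 ≤ q) (hB : ∀ x, x ∈ B ↔ ∑ i, |(x i : ℝ)| ^ q ≤ L)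
    (j : Fin d) :
    (d - L) * ∑ x ∈ B with 0 < x j, (x j : ℝ) ^ 2 ≤ 4 * L * ∑ x ∈ B, (1 + (x j : ℝ) ^ 2) := by
  classical
  set P := (B ×ˢ (Finset.univ : Finset (Fin d))).filter fun z => 0 < z.1 j ∧ z.1 z.2 = 0 with hP
  set Q := (B ×ˢ (Finset.univ : Finset (Fin d))).filter fun z => z.1 z.2 ≠ 0 with hQ
  set φ : (Fin d → ℤ) × Fin d → (Fin d → ℤ) × Fin d := fun z =>
    (Function.update (Function.update z.1 j (z.1 j - 1)) z.2 1, z.2) with hφ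
  set g : (Fin d → ℤ) × Fin d → ℝ := fun z => 4 * (1 + (z.1 j : ℝ) ^ 2) with hg
  have hne : ∀ z ∈ P, z.2 ≠ j := by
    rintro ⟨x, i⟩ hz rfl
    simp only [hP, Finset.mem_filter] at hz
    omega
  have hφj : ∀ z ∈ P, (φ z).1 j = z.1 j - 1 := by
    intro z hz
    simp [hφ, (hne z hz).symm]
  have hinj : Set.InjOn φ P := by
    rintro ⟨x, i⟩ hz ⟨x', i'⟩ hz' h
    have h2 : i = i' := congrArg Prod.snd h
    subst h2
    have hj := hφj _ hz
    have hj' := hφj _ hz'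
    rw [h, hj'] at hj
    simp only [Finset.coe_filter, hP, Set.mem_ofPred_eq] at hz hz'
    have h1 := congrArg Prod.fst h
    refine Prod.ext (funext fun l => ?_) rfl
    by_cases hli : l = i
    · subst hli; exact hz.2.2.trans hz'.2.2.symm
    by_cases hlj : l = j
    · subst hlj; simp only at hj; simp only; omega
    have := congrFun h1 l
    simpa [hφ, hli, hlj] using this
  have hmaps : P.image φ ⊆ Q := by
    intro w hw
    obtain ⟨z, hz, rfl⟩ := Finset.mem_image.1 hw
    simp only [hP, Finset.mem_filter, Finset.mem_product, Finset.mem_univ, and_true] at hz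
    simp only [hQ, Finset.mem_filter, Finset.mem_product, Finset.mem_univ, and_true]
    exact ⟨mem_of_transfer hq hB hz.1 hz.2.1 hz.2.2, by simp [hφ]⟩
  calc (d - L) * ∑ x ∈ B with 0 < x j, (x j : ℝ) ^ 2
      ≤ ∑ x ∈ B with 0 < x j, ∑ i : Fin d with x i = 0, (x j : ℝ) ^ 2 := by
        rw [Finset.mul_sum]
        refine Finset.sum_le_sum fun x hx => ?_
        rw [Finset.sum_const, nsmul_eq_mul]
        refine mul_le_mul_of_nonneg_right ?_ (sq_nonneg _)
        have h1 := card_ne_zero_le hq ((hB x).1 (Finset.mem_filter.1 hx).1)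
        have h2 := Finset.card_filter_add_card_filter_not (s := (Finset.univ : Finset (Fin d)))
          (fun i => x i = 0)
        rw [Finset.card_univ, Fintype.card_fin] at h2
        have h3 : ((Finset.univ.filter fun i => x i = 0).card : ℝ) +
          ((Finset.univ.filter fun i => x i ≠ 0).card : ℝ) = d := by exact_mod_cast h2
        linarith
    _ = ∑ z ∈ P, (z.1 j : ℝ) ^ 2 := by
        rw [hP, Finset.sum_filter, Finset.sum_filter, Finset.sum_product]
        refine Finset.sum_congr rfl fun x _ => ?_
        by_cases h : 0 < x j
        · simp only [h, true_and, if_true]; rw [Finset.sum_filter]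
        · simp [h]
    _ ≤ ∑ z ∈ P, g (φ z) := by
        refine Finset.sum_le_sum fun z hz => ?_
        simp only [hg, hφj z hz]
        push_cast
        -- The inequality is `t² ≤ 4(1 + (t-1)²)`, that is `3t² - 8t + 8 ≥ 0`, whose left side is
        -- minimal at `t = 4/3`.
        nlinarith [sq_nonneg ((z.1 j : ℝ) - 4 / 3)]
    _ = ∑ w ∈ P.image φ, g w := (Finset.sum_image hinj).symm
    _ ≤ ∑ w ∈ Q, g w :=
        Finset.sum_le_sum_of_subset_of_nonneg hmaps fun w _ _ => by simp only [hg]; positivity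
    _ = ∑ x ∈ B, ((Finset.univ.filter fun i => x i ≠ 0).card : ℝ) * (4 * (1 + (x j : ℝ) ^ 2)) := by
        rw [hQ, Finset.sum_filter, Finset.sum_product]
        refine Finset.sum_congr rfl fun x _ => ?_
        rw [← Finset.sum_filter]
        simp only [hg, Finset.sum_const, nsmul_eq_mul]
    _ ≤ ∑ x ∈ B, L * (4 * (1 + (x j : ℝ) ^ 2)) :=
        Finset.sum_le_sum fun x hx => mul_le_mul_of_nonneg_right
          (card_ne_zero_le hq ((hB x).1 hx)) (by positivity)
    _ = _ := by
        rw [Finset.mul_sum]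
        exact Finset.sum_congr rfl fun x _ => by ring

theorem sum_sq_coord_le (hq : 1 ≤ q) (hB : ∀ x, x ∈ B ↔ ∑ i, |(x i : ℝ)| ^ q ≤ L)
    (hLd : 32 * L ≤ d) (j : Fin d) :
    d * ∑ x ∈ B, (x j : ℝ) ^ 2 ≤ 32 * L * B.card := by
  have h1 := sum_sq_pos_coord_le hq hB j
  set S := ∑ x ∈ B, (x j : ℝ) ^ 2 with hS
  have hS0 : 0 ≤ S := Finset.sum_nonneg fun x _ => sq_nonneg _
  have h2 : S = 2 * ∑ x ∈ B with 0 < x j, (x j : ℝ) ^ 2 := by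
    have hneg : ∑ x ∈ B with x j < 0, (x j : ℝ) ^ 2 = ∑ x ∈ B with 0 < x j, (x j : ℝ) ^ 2 := by
      rw [Finset.sum_filter, Finset.sum_filter, ← sum_units_mul hB _ (fun _ => -1)]
      simp
    have h : ∀ x : Fin d → ℤ, (x j : ℝ) ^ 2 = (if x j < 0 then (x j : ℝ) ^ 2 else 0) +
        (if 0 < x j then (x j : ℝ) ^ 2 else 0) := by
      intro x
      rcases lt_trichotomy (x j) 0 with h | h | h
      · simp [h, h.le]
      · simp [h]
      · simp [h, h.le]
    rw [hS, Finset.sum_congr rfl fun x _ => h x, Finset.sum_add_distrib, ← Finset.sum_filter,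
      ← Finset.sum_filter, hneg]
    ring
  rw [Finset.sum_add_distrib, ← hS, Finset.sum_const, nsmul_eq_mul, mul_one] at h1
  -- The sum `S` also occurs on the right with coefficient `4L`; as `32 L ≤ d`, it can be absorbed
  -- into the left.
  nlinarith

end Moment

/-! ### The estimate near a fixed frequency -/

section LowFrequency

variable {d : ℕ} {q L : ℝ} {B : Finset (Fin d → ℤ)}

theorem norm_sum_mul_prod_cos_sub_le (hq : 1 ≤ q)
    (hB : ∀ x, x ∈ B ↔ ∑ i, |(x i : ℝ)| ^ q ≤ L) (hLd : 32 * L ≤ d) (hd : 1 ≤ d)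
    {s : (Fin d → ℤ) → ℂ} (hs : ∀ x, ‖s x‖ = 1) (ξ : Fin d → ℝ) :
    ‖∑ x ∈ B, s x * ((∏ i, Real.cos (2 * Real.pi * (x i * ξ i)) : ℝ) : ℂ) - ∑ x ∈ B, s x‖ ≤
      B.card * (64 * (L / d * ∑ i, Real.sin (Real.pi * ξ i) ^ 2)) := by
  have hd0 : (0 : ℝ) < d := by exact_mod_cast hd
  rw [← Finset.sum_sub_distrib]
  calc _ ≤ ∑ x ∈ B, ∑ i, 2 * ((x i : ℝ) ^ 2 * Real.sin (Real.pi * ξ i) ^ 2) := by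
        refine (norm_sum_le _ _).trans (Finset.sum_le_sum fun x _ => ?_)
        rw [← mul_sub_one, norm_mul, hs, one_mul, norm_sub_rev, ← Complex.ofReal_one,
          ← Complex.ofReal_sub, Complex.norm_real, Real.norm_eq_abs]
        refine (abs_one_sub_prod_le _ fun i => Real.abs_cos_le_one _).trans ?_
        exact Finset.sum_le_sum fun i _ => one_sub_cos_le _ _
    _ = ∑ i, 2 * Real.sin (Real.pi * ξ i) ^ 2 * ∑ x ∈ B, (x i : ℝ) ^ 2 := by
        rw [Finset.sum_comm]
        refine Finset.sum_congr rfl fun i _ => ?_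
        rw [Finset.mul_sum]
        exact Finset.sum_congr rfl fun x _ => by ring
    _ ≤ ∑ i, 2 * Real.sin (Real.pi * ξ i) ^ 2 * (32 * L * B.card / d) := by
        refine Finset.sum_le_sum fun i _ => mul_le_mul_of_nonneg_left ?_ (by positivity)
        rw [le_div_iff₀' hd0]
        exact sum_sq_coord_le hq hB hLd i
    _ = _ := by
        rw [← Finset.sum_mul, ← Finset.mul_sum]
        ring

end LowFrequency

/-! ### Points with few unit coordinates are rare -/

/-- The coordinates of modulus exactly one. -/
def ones {d : ℕ} (x : Fin d → ℤ) : Finset (Fin d) := Finset.univ.filter fun i => |x i| = 1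

section Tail

variable {d : ℕ} {q L : ℝ} {B : Finset (Fin d → ℤ)}

theorem abs_le_abs_rpow (hq : 1 ≤ q) (m : ℤ) : |(m : ℝ)| ≤ |(m : ℝ)| ^ q := by
  rcases eq_or_ne m 0 with rfl | hm
  · simpa using Real.rpow_nonneg le_rfl q
  · exact Real.self_le_rpow_of_one_le (by exact_mod_cast Int.one_le_abs hm) hq

theorem mem_Icc_of_mem (hq : 1 ≤ q) (hB : ∀ x, x ∈ B ↔ ∑ i, |(x i : ℝ)| ^ q ≤ L)
    {x : Fin d → ℤ} (hx : x ∈ B) (i : Fin d) :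
    x i ∈ Finset.Icc (-(⌈L⌉₊ : ℤ)) ⌈L⌉₊ := by
  have h1 : |(x i : ℝ)| ^ q ≤ L :=
    (Finset.single_le_sum (f := fun i => |(x i : ℝ)| ^ q)
      (fun j _ => Real.rpow_nonneg (abs_nonneg _) q) (Finset.mem_univ i)).trans ((hB x).1 hx)
  have h2 : |(x i : ℝ)| ≤ (⌈L⌉₊ : ℝ) :=
    ((abs_le_abs_rpow hq (x i)).trans h1).trans (Nat.le_ceil L)
  have h3 : |x i| ≤ (⌈L⌉₊ : ℤ) := by exact_mod_cast h2
  exact Finset.mem_Icc.2 (abs_le.1 h3)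

/-- Exponential weight that penalises coordinates of modulus one twice. -/
noncomputable def rankinWeight (t : ℝ) (m : ℤ) : ℝ :=
  Real.exp (-(t * (|(m : ℝ)| + if |m| = 1 then 1 else 0)))

/-- The doubled penalty makes moduli one and two both cost `e⁻²ᵗ`; the remaining terms form a
geometric tail of ratio at most `1/64`. -/
theorem sum_range_rankinWeight_le {t : ℝ} (ht : 6 ≤ t) (n : ℕ) :
    ∑ m ∈ Finset.range (n + 2), rankinWeight t m ≤ 1 + 2.02 * Real.exp (-(2 * t)) := by
  set s := Real.exp (-t) with hs
  have hs0 : 0 < s := Real.exp_pos _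
  have hs1 : s ≤ 1 / 64 := by
    have h1 : Real.exp (-t) ≤ Real.exp (-6) := Real.exp_le_exp.2 (by linarith)
    have h2 : (64 : ℝ) ≤ Real.exp 6 := by
      have h3 : (2 : ℝ) ≤ Real.exp 1 := by linarith [Real.add_one_le_exp (1 : ℝ)]
      have h4 : Real.exp 6 = Real.exp 1 ^ 6 := by rw [← Real.exp_nat_mul]; norm_num
      rw [h4]
      calc (64 : ℝ) = 2 ^ 6 := by norm_num
        _ ≤ _ := pow_le_pow_left₀ (by norm_num) h3 6
    refine h1.trans ?_
    rw [Real.exp_neg, ← one_div]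
    exact one_div_le_one_div_of_le (by norm_num) h2
  have hs2 : Real.exp (-(2 * t)) = s ^ 2 := by rw [hs, ← Real.exp_nat_mul]; ring_nf
  have hge : ∀ m : ℕ, rankinWeight t ((m + 1 + 1 : ℕ) : ℤ) = s ^ 2 * s ^ m := by
    intro m
    have : ¬ |((m + 1 + 1 : ℕ) : ℤ)| = 1 := by
      rw [Nat.abs_cast]; omega
    rw [rankinWeight, if_neg this, hs, ← pow_add, ← Real.exp_nat_mul]
    push_cast
    rw [abs_of_nonneg (by positivity)]
    ring_nf
  have hgeom : ∑ m ∈ Finset.range n, s ^ m ≤ 1.02 := by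
    have hsum := (summable_geometric_of_lt_one hs0.le (by linarith)).sum_le_tsum
      (Finset.range n) (fun m _ => pow_nonneg hs0.le m)
    rw [tsum_geometric_of_lt_one hs0.le (by linarith)] at hsum
    refine hsum.trans ?_
    rw [inv_le_comm₀ (by linarith) (by norm_num)]
    norm_num
    linarith
  rw [Finset.sum_range_succ', Finset.sum_range_succ', Finset.sum_congr rfl fun m _ => hge m,
    ← Finset.mul_sum, hs2]
  have h1 : rankinWeight t ((0 + 1 : ℕ) : ℤ) = s ^ 2 := by
    rw [← hs2, rankinWeight]; norm_num; ring
  have h0 : rankinWeight t ((0 : ℕ) : ℤ) = 1 := by simp [rankinWeight]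
  rw [h0, h1]
  nlinarith [sq_nonneg s]

theorem sum_Icc_rankinWeight_le {t : ℝ} (ht : 6 ≤ t) {n : ℕ} (hn : 1 ≤ n) :
    ∑ m ∈ Finset.Icc (-(n : ℤ)) n, rankinWeight t m ≤ 1 + 4.04 * Real.exp (-(2 * t)) := by
  have heven : Function.Even (rankinWeight t) := fun m => by simp [rankinWeight]
  obtain ⟨n, rfl⟩ : ∃ m, n = m + 1 := ⟨n - 1, by omega⟩
  rw [Finset.sum_Icc_of_even_eq_range heven]
  have h := sum_range_rankinWeight_le ht n
  have h0 : rankinWeight t 0 = 1 := by simp [rankinWeight]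
  rw [h0, nsmul_eq_mul]
  push_cast
  linarith

theorem exp_neg_le_prod_rankinWeight (hq : 1 ≤ q) {t K : ℝ} (ht : 0 ≤ t) {x : Fin d → ℤ}
    (hx : ∑ i, |(x i : ℝ)| ^ q ≤ L) (hk : ((ones x).card : ℝ) ≤ K) :
    Real.exp (-(t * (L + K))) ≤ ∏ i, rankinWeight t (x i) := by
  simp only [rankinWeight]
  rw [← Real.exp_sum, Real.exp_le_exp, Finset.sum_neg_distrib, neg_le_neg_iff, ← Finset.mul_sum]
  refine mul_le_mul_of_nonneg_left ?_ ht
  rw [Finset.sum_add_distrib]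
  refine add_le_add ((Finset.sum_le_sum fun i _ => abs_le_abs_rpow hq (x i)).trans hx) ?_
  refine le_trans (le_of_eq ?_) hk
  simp [ones]

/-- Rankin's trick: every counted point has product weight at least `e^(-t(L+K))`, while the total
weight over a box containing the ball factorises over coordinates. -/
theorem card_filter_ones_mul_exp_le (hq : 1 ≤ q) (hB : ∀ x, x ∈ B ↔ ∑ i, |(x i : ℝ)| ^ q ≤ L)
    (hL : 0 < L) {t K : ℝ} (ht : 6 ≤ t) :
    ((B.filter fun x => ((ones x).card : ℝ) ≤ K).card : ℝ) * Real.exp (-(t * (L + K))) ≤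
      Real.exp (4.04 * (d * Real.exp (-(2 * t)))) := by
  set R := ⌈L⌉₊ with hR
  have hR1 : 1 ≤ R := Nat.one_le_ceil_iff.2 hL
  have hnn : ∀ m, 0 ≤ rankinWeight t m := fun m => (Real.exp_pos _).le
  calc _ = ∑ x ∈ B.filter fun x => ((ones x).card : ℝ) ≤ K, Real.exp (-(t * (L + K))) := by
        rw [Finset.sum_const, nsmul_eq_mul]
    _ ≤ ∑ x ∈ B.filter fun x => ((ones x).card : ℝ) ≤ K, ∏ i, rankinWeight t (x i) := by
        refine Finset.sum_le_sum fun x hx => ?_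
        rw [Finset.mem_filter] at hx
        exact exp_neg_le_prod_rankinWeight hq (by linarith) ((hB x).1 hx.1) hx.2
    _ ≤ ∑ x ∈ Fintype.piFinset fun _ : Fin d => Finset.Icc (-(R : ℤ)) R,
          ∏ i, rankinWeight t (x i) := by
        refine Finset.sum_le_sum_of_subset_of_nonneg (fun x hx => ?_)
          (fun x _ _ => Finset.prod_nonneg fun i _ => hnn _)
        exact Fintype.mem_piFinset.2 fun i => mem_Icc_of_mem hq hB (Finset.mem_filter.1 hx).1 i
    _ = (∑ m ∈ Finset.Icc (-(R : ℤ)) R, rankinWeight t m) ^ d := by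
        rw [← Finset.prod_univ_sum (fun _ : Fin d => Finset.Icc (-(R : ℤ)) R)
          (fun _ m => rankinWeight t m)]
        simp
    _ ≤ Real.exp (4.04 * Real.exp (-(2 * t))) ^ d := by
        refine pow_le_pow_left₀ (Finset.sum_nonneg fun m _ => hnn m) ?_ d
        refine (sum_Icc_rankinWeight_le ht hR1).trans ?_
        rw [add_comm]
        exact Real.add_one_le_exp _
    _ = _ := by rw [← Real.exp_nat_mul]; ring_nf

/-- Indicator vectors of `⌊L⌋`-subsets lie in the ball. -/
theorem choose_floor_le_card (hq : 1 ≤ q) (hB : ∀ x, x ∈ B ↔ ∑ i, |(x i : ℝ)| ^ q ≤ L)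
    (hL : 0 ≤ L) : d.choose ⌊L⌋₊ ≤ B.card := by
  classical
  have h : (((Finset.univ : Finset (Fin d)).powersetCard ⌊L⌋₊).image
      fun I i => if i ∈ I then (1 : ℤ) else 0) ⊆ B := by
    intro x hx
    obtain ⟨I, hI, rfl⟩ := Finset.mem_image.1 hx
    rw [hB]
    have : ∀ i, |((if i ∈ I then (1 : ℤ) else 0 : ℤ) : ℝ)| ^ q = if i ∈ I then (1 : ℝ) else 0 := by
      intro i
      split_ifs
      · simp
      · simp [Real.zero_rpow (by linarith : q ≠ 0)]
    simp only [this]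
    rw [Finset.sum_ite_mem, Finset.univ_inter, Finset.sum_const, nsmul_eq_mul, mul_one,
      (Finset.mem_powersetCard.1 hI).2]
    exact Nat.floor_le hL
  have hcard := Finset.card_le_card h
  rwa [Finset.card_image_of_injective, Finset.card_powersetCard, Finset.card_univ,
    Fintype.card_fin] at hcard
  intro I I' hII
  ext i
  have := congrFun hII i
  by_cases h1 : i ∈ I <;> by_cases h2 : i ∈ I' <;> simp_all

theorem pow_le_choose_of_two_mul_le {K : ℕ} (hK : 2 * K ≤ d) (hKL : (K : ℝ) ≤ L) (hL : 0 < L) :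
    ((d : ℝ) / (2 * L)) ^ K ≤ d.choose K := by
  have h1 : ((d + 1 - K : ℕ) : ℝ) ^ K ≤ K.factorial * d.choose K := by
    have := Nat.pow_le_choose (α := ℝ) K d
    rwa [div_le_iff₀' (by positivity)] at this
  have h2 : (K.factorial : ℝ) ≤ L ^ K := by
    have : (K.factorial : ℝ) ≤ (K : ℝ) ^ K := by exact_mod_cast Nat.factorial_le_pow K
    exact this.trans (pow_le_pow_left₀ (Nat.cast_nonneg _) hKL K)
  have h3 : (d : ℝ) / 2 ≤ ((d + 1 - K : ℕ) : ℝ) := by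
    have : (d : ℝ) ≤ 2 * ((d + 1 - K : ℕ) : ℝ) := by
      exact_mod_cast (by omega : d ≤ 2 * (d + 1 - K))
    linarith
  have h4 : (0 : ℝ) < L ^ K := by positivity
  rw [show (d : ℝ) / (2 * L) = d / 2 / L by field_simp, div_pow, div_le_iff₀ h4]
  calc ((d : ℝ) / 2) ^ K ≤ ((d + 1 - K : ℕ) : ℝ) ^ K := pow_le_pow_left₀ (by positivity) h3 K
    _ ≤ _ := h1
    _ ≤ L ^ K * d.choose K := mul_le_mul_of_nonneg_right h2 (Nat.cast_nonneg _)
    _ = _ := mul_comm _ _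

theorem card_filter_ones_le (hq : 1 ≤ q) (hB : ∀ x, x ∈ B ↔ ∑ i, |(x i : ℝ)| ^ q ≤ L)
    (hL : 20 ≤ L) (hLd : L ≤ Real.exp (-12) * d) :
    ((B.filter fun x => ((ones x).card : ℝ) ≤ L / 80).card : ℝ) ≤ 2 / L * B.card := by
  have hL0 : 0 < L := by linarith
  have hd0 : (0 : ℝ) < d := by
    by_contra h
    have : (d : ℝ) ≤ 0 := not_lt.1 h
    nlinarith [Real.exp_pos (-12)]
  set lam := Real.log (d / L) with hlam
  have hexp : Real.exp lam = d / L := Real.exp_log (by positivity)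
  have hlam12 : 12 ≤ lam := by
    rw [hlam, Real.le_log_iff_exp_le (by positivity), le_div_iff₀ hL0]
    calc Real.exp 12 * L ≤ Real.exp 12 * (Real.exp (-12) * d) :=
          mul_le_mul_of_nonneg_left hLd (Real.exp_pos _).le
      _ = d := by rw [← mul_assoc, ← Real.exp_add]; simp
  -- The choice `t = lam / 2` makes `d e⁻²ᵗ = L`, so the total weight is at most `e^(4.04 L)`.
  have hbad := card_filter_ones_mul_exp_le hq hB hL0 (t := lam / 2) (K := L / 80) (by linarith)
  rw [show 2 * (lam / 2) = lam by ring, Real.exp_neg lam, hexp, inv_div,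
    mul_div_cancel₀ _ hd0.ne', ← le_div_iff₀ (Real.exp_pos _), ← Real.exp_sub] at hbad
  set K := ⌊L⌋₊ with hK
  have hKL : (K : ℝ) ≤ L := Nat.floor_le hL0.le
  have hLK : L < K + 1 := Nat.lt_floor_add_one L
  have hLd2 : 2 * L ≤ d := by
    have h2 : Real.exp (-12) ≤ 1 / 2 := by
      rw [Real.exp_neg, ← one_div]
      exact one_div_le_one_div_of_le (by norm_num) (by linarith [Real.add_one_le_exp (12 : ℝ)])
    nlinarith
  have hKd : 2 * K ≤ d := by
    have : (2 : ℝ) * K ≤ d := by linarith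
    exact_mod_cast this
  have hcard : Real.exp ((lam - 0.7) * K) ≤ B.card := by
    have h1 := pow_le_choose_of_two_mul_le hKd hKL hL0
    have h2 : (d.choose K : ℝ) ≤ B.card := by exact_mod_cast choose_floor_le_card hq hB hL0.le
    refine le_trans ?_ (h1.trans h2)
    rw [mul_comm, Real.exp_nat_mul]
    refine pow_le_pow_left₀ (Real.exp_pos _).le ?_ K
    rw [Real.exp_sub, hexp, div_div, mul_comm L]
    refine div_le_div_of_nonneg_left hd0.le (by positivity) ?_
    refine mul_le_mul_of_nonneg_right ?_ hL0.le
    rw [← Real.log_le_iff_le_exp (by norm_num)]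
    linarith [Real.log_two_lt_d9]
  have hinv : Real.exp (-(L / 2)) ≤ 2 / L := by
    rw [Real.exp_neg, ← inv_div L 2]
    exact inv_anti₀ (by positivity) (by linarith [Real.add_one_le_exp (L / 2)])
  have hK95 : 0.95 * L ≤ K := by linarith
  -- The count of exceptional points grows like `e^(0.50625 lam L)`, the ball at least like `e^(0.95
  -- lam L)`, up to factors `e^(O(L))`. Their gap `0.44375 lam` exceeds the required `4.04 + 0.665 +
  -- 0.5` once `lam ≥ 12`; this is where `e⁻¹²` is needed.
  have hexpo : 4.04 * L - -(lam / 2 * (L + L / 80)) ≤ -(L / 2) + (lam - 0.7) * K := by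
    have h1 : (lam - 0.7) * (0.95 * L) ≤ (lam - 0.7) * K :=
      mul_le_mul_of_nonneg_left hK95 (by linarith)
    have h2 : 12 * L ≤ lam * L := mul_le_mul_of_nonneg_right hlam12 hL0.le
    linarith
  calc _ ≤ Real.exp (-(L / 2) + (lam - 0.7) * K) := hbad.trans (Real.exp_le_exp.2 hexpo)
    _ = Real.exp (-(L / 2)) * Real.exp ((lam - 0.7) * K) := Real.exp_add _ _
    _ ≤ 2 / L * B.card := mul_le_mul hinv hcard (Real.exp_pos _).le (by positivity)

end Tail

/-! ### Classes of points by small and unit coordinates -/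

section Fibers

variable {d : ℕ} {q L : ℝ} {B : Finset (Fin d → ℤ)}

/-- The coordinates of modulus at most one. -/
def small (x : Fin d → ℤ) : Finset (Fin d) := Finset.univ.filter fun i => |x i| ≤ 1

theorem ones_subset_small (x : Fin d → ℤ) : ones x ⊆ small x := by
  intro i hi
  simp only [ones, small, Finset.mem_filter, Finset.mem_univ, true_and] at *
  exact hi.le

/-- The points of `B` whose small coordinates are `U` and whose unit coordinates are `I`. -/
def fiber (B : Finset (Fin d → ℤ)) (U I : Finset (Fin d)) : Finset (Fin d → ℤ) :=
  B.filter fun x => small x = U ∧ ones x = I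

/-- The points of `B` with `n` small coordinates and `k` unit coordinates. -/
def level (B : Finset (Fin d → ℤ)) (n k : ℕ) : Finset (Fin d → ℤ) :=
  B.filter fun x => (small x).card = n ∧ (ones x).card = k

theorem exists_perm_of_card_fiber_eq {α γ : Type*} [Fintype α] [DecidableEq γ] (f g : α → γ)
    (h : ∀ c, (Finset.univ.filter fun a => f a = c).card =
      (Finset.univ.filter fun a => g a = c).card) :
    ∃ σ : Equiv.Perm α, ∀ a, g (σ a) = f a := by
  have h' : ∀ c, Nonempty ({a // f a = c} ≃ {a // g a = c}) := fun c =>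
    ⟨Fintype.equivOfCardEq (by rw [Fintype.card_subtype, Fintype.card_subtype]; exact h c)⟩
  exact ⟨Equiv.ofFiberEquiv fun c => (h' c).some, Equiv.ofFiberEquiv_map _⟩

theorem exists_perm_pair {α : Type*} [Fintype α] [DecidableEq α] {U U' I I' : Finset α}
    (hI : I ⊆ U) (hI' : I' ⊆ U') (hU : U.card = U'.card) (hc : I.card = I'.card) :
    ∃ σ : Equiv.Perm α, (∀ a, σ a ∈ U' ↔ a ∈ U) ∧ ∀ a, σ a ∈ I' ↔ a ∈ I := by
  have hcard : ∀ {U I : Finset α}, I ⊆ U → ∀ c : Bool × Bool,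
      (Finset.univ.filter fun a => (decide (a ∈ U), decide (a ∈ I)) = c).card =
        if c = (true, true) then I.card else if c = (true, false) then U.card - I.card
          else if c = (false, false) then Fintype.card α - U.card else 0 := by
    intro U I h c
    rcases c with ⟨_ | _, _ | _⟩
    · simp only [Prod.mk.injEq, decide_eq_false_iff_not]
      rw [← Finset.card_compl]
      simp
      congr 1
      ext a
      simp
      exact fun h1 h2 => h1 (h h2)
    · simp
      exact fun a h1 h2 => h1 (h h2)
    · simp
      rw [← Finset.card_sdiff_of_subset h]
      congr 1
      ext a
      simp
    · simp
      congr 1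
      ext a
      simp
      exact fun h1 => h h1
  obtain ⟨σ, hσ⟩ := exists_perm_of_card_fiber_eq
    (fun a => (decide (a ∈ U), decide (a ∈ I))) (fun a => (decide (a ∈ U'), decide (a ∈ I')))
    (fun c => by rw [hcard hI, hcard hI', hU, hc])
  refine ⟨σ, fun a => ?_, fun a => ?_⟩
  · simpa using congrArg Prod.fst (hσ a)
  · simpa using congrArg Prod.snd (hσ a)

theorem exists_perm_fix_compl {α : Type*} [Fintype α] [DecidableEq α] {U I I' : Finset α}
    (hI : I ⊆ U) (hI' : I' ⊆ U) (hc : I.card = I'.card) :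
    ∃ σ : Equiv.Perm α, (∀ a, a ∉ U → σ a = a) ∧ (∀ a, σ a ∈ U ↔ a ∈ U) ∧
      ∀ a, σ a ∈ I' ↔ a ∈ I := by
  -- Points outside `U` each receive their own colour, so a colour-preserving permutation must fix
  -- them.
  have hcard : ∀ {I : Finset α}, I ⊆ U → ∀ c : Option α × Bool,
      (Finset.univ.filter fun a => (if a ∈ U then none else some a, decide (a ∈ I)) = c).card =
        if c = (none, true) then I.card else if c = (none, false) then U.card - I.card
          else if ∃ a, a ∉ U ∧ c = (some a, false) then 1 else 0 := by
    intro I h c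
    rcases c with ⟨_ | a, _ | _⟩
    · simp
      rw [← Finset.card_sdiff_of_subset h]
      congr 1
      ext a
      simp
    · simp
      congr 1
      ext a
      simp
      exact fun h1 => h h1
    · by_cases ha : a ∈ U
      · simp [ha]
        rintro b hb rfl
        exact absurd ha hb
      · simp [ha]
        rw [Finset.card_eq_one]
        refine ⟨a, ?_⟩
        ext b
        simp
        constructor
        · rintro ⟨⟨_, h2⟩, _⟩; exact h2
        · rintro rfl; exact ⟨⟨ha, rfl⟩, fun h1 => ha (h h1)⟩
    · simp
      exact fun b h1 _ h2 => h1 (h h2)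
  obtain ⟨σ, hσ⟩ := exists_perm_of_card_fiber_eq
    (fun a => (if a ∈ U then none else some a, decide (a ∈ I)))
    (fun a => (if a ∈ U then none else some a, decide (a ∈ I')))
    (fun c => by rw [hcard hI, hcard hI', hc])
  refine ⟨σ, fun a ha => ?_, fun a => ?_, fun a => ?_⟩
  · have h := congrArg Prod.fst (hσ a)
    simp only [ha, if_false] at h
    by_cases h' : σ a ∈ U
    · simp [h'] at h
    · simpa [h'] using h
  · have h := congrArg Prod.fst (hσ a)
    by_cases h1 : σ a ∈ U <;> by_cases h2 : a ∈ U <;> simp_all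
  · simpa using congrArg Prod.snd (hσ a)

theorem small_comp_eq_iff {U U' : Finset (Fin d)} {σ : Equiv.Perm (Fin d)}
    (hσ : ∀ a, σ a ∈ U' ↔ a ∈ U) (x : Fin d → ℤ) : small (x ∘ σ) = U ↔ small x = U' := by
  simp only [small, Finset.ext_iff, Finset.mem_filter, Finset.mem_univ, true_and,
    Function.comp_apply]
  rw [← σ.forall_congr_right (q := fun a => |x a| ≤ 1 ↔ a ∈ U')]
  simp only [hσ]

theorem ones_comp_eq_iff {I I' : Finset (Fin d)} {σ : Equiv.Perm (Fin d)}
    (hσ : ∀ a, σ a ∈ I' ↔ a ∈ I) (x : Fin d → ℤ) : ones (x ∘ σ) = I ↔ ones x = I' := by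
  simp only [ones, Finset.ext_iff, Finset.mem_filter, Finset.mem_univ, true_and,
    Function.comp_apply]
  rw [← σ.forall_congr_right (q := fun a => |x a| = 1 ↔ a ∈ I')]
  simp only [hσ]

theorem sum_fiber_comp_perm (hB : ∀ x, x ∈ B ↔ ∑ i, |(x i : ℝ)| ^ q ≤ L)
    {U U' I I' : Finset (Fin d)} {σ : Equiv.Perm (Fin d)} (hσU : ∀ a, σ a ∈ U' ↔ a ∈ U)
    (hσI : ∀ a, σ a ∈ I' ↔ a ∈ I) {M : Type*} [AddCommMonoid M] (g : (Fin d → ℤ) → M) :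
    ∑ x ∈ fiber B U' I', g (x ∘ σ) = ∑ x ∈ fiber B U I, g x := by
  rw [fiber, fiber, Finset.sum_filter, Finset.sum_filter]
  refine Eq.trans ?_ (sum_comp_perm hB _ σ)
  simp only [small_comp_eq_iff hσU, ones_comp_eq_iff hσI]

theorem card_fiber_eq (hB : ∀ x, x ∈ B ↔ ∑ i, |(x i : ℝ)| ^ q ≤ L)
    {U U' I I' : Finset (Fin d)} (hI : I ⊆ U) (hI' : I' ⊆ U') (hU : U.card = U'.card)
    (hc : I.card = I'.card) : (fiber B U I).card = (fiber B U' I').card := by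
  obtain ⟨σ, h1, h2⟩ := exists_perm_pair hI hI' hU hc
  rw [Finset.card_eq_sum_ones, Finset.card_eq_sum_ones]
  exact (sum_fiber_comp_perm hB h1 h2 fun _ => 1).symm

theorem sum_fiber_compl_eq (hB : ∀ x, x ∈ B ↔ ∑ i, |(x i : ℝ)| ^ q ≤ L)
    {U I I' : Finset (Fin d)} (hI : I ⊆ U) (hI' : I' ⊆ U) (hc : I.card = I'.card)
    (f : ℤ → Fin d → ℝ) :
    ∑ x ∈ fiber B U I, ∏ i ∈ Uᶜ, f (x i) i = ∑ x ∈ fiber B U I', ∏ i ∈ Uᶜ, f (x i) i := by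
  obtain ⟨σ, h0, h1, h2⟩ := exists_perm_fix_compl hI hI' hc
  rw [← sum_fiber_comp_perm hB h1 h2]
  refine Finset.sum_congr rfl fun x _ => Finset.prod_congr rfl fun i hi => ?_
  rw [Function.comp_apply, h0 i (Finset.mem_compl.1 hi)]

theorem sum_level_eq {M : Type*} [AddCommMonoid M] (n k : ℕ) (g : (Fin d → ℤ) → M) :
    ∑ x ∈ level B n k, g x =
      ∑ U ∈ (Finset.univ : Finset (Fin d)).powersetCard n, ∑ I ∈ U.powersetCard k,
        ∑ x ∈ fiber B U I, g x := by
  rw [← Finset.sum_fiberwise_of_maps_to (s := level B n k)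
    (t := (Finset.univ : Finset (Fin d)).powersetCard n) (g := small)]
  · refine Finset.sum_congr rfl fun U hU => ?_
    rw [← Finset.sum_fiberwise_of_maps_to (t := U.powersetCard k) (g := ones)]
    · refine Finset.sum_congr rfl fun I hI => Finset.sum_congr ?_ fun _ _ => rfl
      rw [Finset.mem_powersetCard] at hU hI
      ext x
      simp only [level, fiber, Finset.mem_filter]
      constructor
      · rintro ⟨⟨⟨h1, -⟩, h2⟩, h3⟩; exact ⟨h1, h2, h3⟩
      · rintro ⟨h1, rfl, rfl⟩; exact ⟨⟨⟨h1, hU.2, hI.2⟩, rfl⟩, rfl⟩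
    · intro x hx
      simp only [level, Finset.mem_filter] at hx
      rw [Finset.mem_powersetCard]
      exact ⟨hx.2 ▸ ones_subset_small x, hx.1.2.2⟩
  · intro x hx
    simp only [level, Finset.mem_filter] at hx
    exact Finset.mem_powersetCard.2 ⟨Finset.subset_univ _, hx.2.1⟩

/-- Zero coordinates contribute 1 and unit coordinates `cos(2πξ_i)`, whatever their sign, so the
factor over `U` is constant on the fiber. -/
theorem sum_fiber_prod_cos (U I : Finset (Fin d)) (hI : I ⊆ U) (ξ : Fin d → ℝ) :
    ∑ x ∈ fiber B U I, ∏ i, Real.cos (2 * Real.pi * (x i * ξ i)) =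
      (∏ i ∈ I, (1 - 2 * Real.sin (Real.pi * ξ i) ^ 2)) *
        ∑ x ∈ fiber B U I, ∏ i ∈ Uᶜ, Real.cos (2 * Real.pi * (x i * ξ i)) := by
  rw [Finset.mul_sum]
  refine Finset.sum_congr rfl fun x hx => ?_
  obtain ⟨-, rfl, rfl⟩ := Finset.mem_filter.1 hx
  rw [← Finset.prod_mul_prod_compl (small x)]
  congr 1
  rw [← Finset.prod_subset hI]
  · refine Finset.prod_congr rfl fun i hi => ?_
    simp only [ones, Finset.mem_filter, Finset.mem_univ, true_and] at hi
    have hcos : Real.cos (2 * Real.pi * ξ i) = 1 - 2 * Real.sin (Real.pi * ξ i) ^ 2 := by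
      rw [mul_assoc, Real.cos_two_mul, Real.cos_sq']; ring
    rcases (abs_eq zero_le_one).1 hi with h | h
    · rw [h, ← hcos]; simp
    · rw [h, ← hcos]; simp
  · intro i hi hi'
    simp only [ones, small, Finset.mem_filter, Finset.mem_univ, true_and] at hi hi'
    have : x i = 0 := by
      rw [← abs_eq_zero]
      have := abs_nonneg (x i)
      omega
    simp [this]

/-- For fixed `U`, the sum over the large coordinates does not depend on `I`, by permutations fixing
`Uᶜ`. It factors out and is bounded by the common fiber size, leaving a subset average to which the
Krawtchouk bound applies. -/
theorem abs_sum_level_le {c : ℝ} (hc : IsKrawtchoukConstant c)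
    (hB : ∀ x, x ∈ B ↔ ∑ i, |(x i : ℝ)| ^ q ≤ L) {n k : ℕ} (hn : d ≤ 2 * n) (hnd : n ≤ d)
    (hk : 2 * k ≤ n) (ξ : Fin d → ℝ) :
    |∑ x ∈ level B n k, ∏ i, Real.cos (2 * Real.pi * (x i * ξ i))| ≤
      (level B n k).card *
        (Real.exp (-(c * k / n / 4 * ∑ i, Real.sin (Real.pi * ξ i) ^ 2)) +
          Real.exp (-(c * k / n / 4 * ∑ i, (1 - Real.sin (Real.pi * ξ i) ^ 2)))) := by
  obtain ⟨U₀, -, hU₀⟩ := Finset.exists_subset_card_eq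
    (s := (Finset.univ : Finset (Fin d))) (n := n) (by simpa using hnd)
  obtain ⟨I₀, hI₀U, hI₀⟩ := Finset.exists_subset_card_eq (s := U₀) (n := k) (by omega)
  have hcard : ((level B n k).card : ℝ) =
      (fiber B U₀ I₀).card * ((d.choose n : ℝ) * n.choose k) := by
    have h : (level B n k).card = (fiber B U₀ I₀).card * (d.choose n * n.choose k) := by
      rw [Finset.card_eq_sum_ones, sum_level_eq]
      have : ∀ U ∈ (Finset.univ : Finset (Fin d)).powersetCard n,
          ∑ I ∈ U.powersetCard k, ∑ _x ∈ fiber B U I, 1 =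
            n.choose k * (fiber B U₀ I₀).card := by
        intro U hU
        rw [Finset.mem_powersetCard] at hU
        rw [Finset.sum_congr rfl (g := fun _ => (fiber B U₀ I₀).card), Finset.sum_const,
          Finset.card_powersetCard, hU.2, smul_eq_mul]
        intro I hI
        rw [Finset.mem_powersetCard] at hI
        rw [← Finset.card_eq_sum_ones]
        exact card_fiber_eq hB hI.1 hI₀U (by omega) (by omega)
      rw [Finset.sum_congr rfl this, Finset.sum_const, Finset.card_powersetCard,
        Finset.card_univ, Fintype.card_fin, smul_eq_mul]
      ring
    exact_mod_cast h
  have hkr := hc.sum_abs_sum_powersetCard_le (Finset.univ : Finset (Fin d)) (n := n) (k := k)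
    (by simpa using hn) hk (p := fun i => Real.sin (Real.pi * ξ i) ^ 2) (fun i => sq_nonneg _)
    (fun i => Real.sin_sq_le_one _)
  rw [Finset.card_univ, Fintype.card_fin] at hkr
  rw [sum_level_eq, hcard]
  calc _ ≤ ∑ U ∈ (Finset.univ : Finset (Fin d)).powersetCard n, ((fiber B U₀ I₀).card : ℝ) *
          |∑ I ∈ U.powersetCard k, ∏ i ∈ I, (1 - 2 * Real.sin (Real.pi * ξ i) ^ 2)| := by
        refine (Finset.abs_sum_le_sum_abs _ _).trans (Finset.sum_le_sum fun U hU => ?_)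
        rw [Finset.mem_powersetCard] at hU
        obtain ⟨I₁, hI₁U, hI₁⟩ := Finset.exists_subset_card_eq (s := U) (n := k) (by omega)
        have hsum : ∑ I ∈ U.powersetCard k,
            ∑ x ∈ fiber B U I, ∏ i, Real.cos (2 * Real.pi * (x i * ξ i)) =
            (∑ x ∈ fiber B U I₁, ∏ i ∈ Uᶜ, Real.cos (2 * Real.pi * (x i * ξ i))) *
              ∑ I ∈ U.powersetCard k, ∏ i ∈ I, (1 - 2 * Real.sin (Real.pi * ξ i) ^ 2) := by
          rw [Finset.mul_sum]
          refine Finset.sum_congr rfl fun I hI => ?_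
          rw [Finset.mem_powersetCard] at hI
          rw [sum_fiber_prod_cos U I hI.1, mul_comm]
          congr 1
          exact sum_fiber_compl_eq hB hI.1 hI₁U (by omega)
            fun m i => Real.cos (2 * Real.pi * (m * ξ i))
        rw [hsum, abs_mul]
        refine mul_le_mul_of_nonneg_right ?_ (abs_nonneg _)
        rw [card_fiber_eq hB hI₀U hI₁U (by omega) (by omega)]
        refine (Finset.abs_sum_le_sum_abs _ _).trans ?_
        rw [Finset.card_eq_sum_ones, Nat.cast_sum]
        refine Finset.sum_le_sum fun x _ => ?_
        rw [Finset.abs_prod, Nat.cast_one]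
        exact Finset.prod_le_one (fun i _ => abs_nonneg _) fun i _ => Real.abs_cos_le_one _
    _ ≤ _ := by
        rw [← Finset.mul_sum, mul_assoc]
        exact mul_le_mul_of_nonneg_left hkr (Nat.cast_nonneg _)

end Fibers

/-! ### Exponential decay of the cosine average -/

section Decay

variable {d : ℕ} {q L : ℝ} {B : Finset (Fin d → ℤ)}

theorem abs_sum_prod_cos_le {c : ℝ} (hc : IsKrawtchoukConstant c) (hq : 1 ≤ q)
    (hB : ∀ x, x ∈ B ↔ ∑ i, |(x i : ℝ)| ^ q ≤ L) (hL : 20 ≤ L)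
    (hLd : L ≤ Real.exp (-12) * d) (hLd4 : 4 * L ≤ d) (ξ : Fin d → ℝ) :
    |∑ x ∈ B, ∏ i, Real.cos (2 * Real.pi * (x i * ξ i))| ≤
      B.card * (2 * Real.exp (-(c * (L / d) / 320 *
        min (∑ i, Real.sin (Real.pi * ξ i) ^ 2) (∑ i, (1 - Real.sin (Real.pi * ξ i) ^ 2))))
        + 2 / L) := by
  set S := ∑ i, Real.sin (Real.pi * ξ i) ^ 2 with hS
  set S' := ∑ i, (1 - Real.sin (Real.pi * ξ i) ^ 2) with hS'
  have hS0 : 0 ≤ S := Finset.sum_nonneg fun i _ => sq_nonneg _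
  have hS'0 : 0 ≤ S' := Finset.sum_nonneg fun i _ => sub_nonneg.2 (Real.sin_sq_le_one _)
  set E := Real.exp (-(c * (L / d) / 320 * min S S')) with hE
  set F : (Fin d → ℤ) → ℝ := fun x => ∏ i, Real.cos (2 * Real.pi * (x i * ξ i)) with hF
  have hF1 : ∀ x, |F x| ≤ 1 := fun x => by
    rw [hF, Finset.abs_prod]
    exact Finset.prod_le_one (fun i _ => abs_nonneg _) fun i _ => Real.abs_cos_le_one _
  set B₁ := B.filter fun x => ((ones x).card : ℝ) ≤ L / 80 with hB₁
  set B₂ := B.filter fun x => ¬ ((ones x).card : ℝ) ≤ L / 80 with hB₂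
  have hbad : |∑ x ∈ B₁, F x| ≤ 2 / L * B.card := by
    refine le_trans ?_ (card_filter_ones_le hq hB hL hLd)
    refine (Finset.abs_sum_le_sum_abs _ _).trans ?_
    refine (Finset.sum_le_sum fun x _ => hF1 x).trans_eq ?_
    rw [Finset.sum_const, nsmul_eq_mul, mul_one]
  have hgood : |∑ x ∈ B₂, F x| ≤ B₂.card * (2 * E) := by
    set pr : (Fin d → ℤ) → ℕ × ℕ := fun x => ((small x).card, (ones x).card) with hpr
    have hmaps : ∀ x ∈ B₂, pr x ∈ B₂.image pr := fun x hx => Finset.mem_image_of_mem _ hx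
    rw [← Finset.sum_fiberwise_of_maps_to hmaps, Finset.card_eq_sum_card_fiberwise hmaps,
      Nat.cast_sum, Finset.sum_mul]
    refine (Finset.abs_sum_le_sum_abs _ _).trans (Finset.sum_le_sum fun p hp => ?_)
    obtain ⟨x, hx, rfl⟩ := Finset.mem_image.1 hp
    obtain ⟨hxB, hxL⟩ := Finset.mem_filter.1 hx
    -- Whether a point is exceptional depends only on its number of unit coordinates, so each
    -- non-exceptional class is a full level of `B`.
    have hlevel : B₂.filter (fun y => pr y = pr x) = level B (small x).card (ones x).card := by
      ext y
      simp only [hB₂, level, hpr, Finset.mem_filter, Prod.mk.injEq]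
      constructor
      · rintro ⟨⟨h1, -⟩, h2⟩; exact ⟨h1, h2⟩
      · rintro ⟨h1, h2⟩; exact ⟨⟨h1, by rw [h2.2]; exact hxL⟩, h2⟩
    rw [hlevel]
    set n := (small x).card with hn
    set k := (ones x).card with hk
    have hne := card_ne_zero_le hq ((hB x).1 hxB)
    have hnd : n ≤ d := (Finset.card_le_univ _).trans_eq (Fintype.card_fin d)
    have hkL : (k : ℝ) ≤ L := by
      refine le_trans ?_ hne
      refine Nat.cast_le.2 (Finset.card_le_card fun i hi => ?_)
      simp only [ones, Finset.mem_filter, Finset.mem_univ, true_and] at hi ⊢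
      rintro h
      simp [h] at hi
    have hnL : (d : ℝ) - L ≤ n := by
      have h1 : (small x)ᶜ.card = d - n := by rw [Finset.card_compl, Fintype.card_fin]
      have h2 : ((d - n : ℕ) : ℝ) ≤ L := by
        rw [← h1]
        refine le_trans ?_ hne
        refine Nat.cast_le.2 (Finset.card_le_card fun i hi => ?_)
        simp only [small, Finset.mem_compl, Finset.mem_filter, Finset.mem_univ, true_and] at hi ⊢
        rintro h
        simp [h] at hi
      rw [Nat.cast_sub hnd] at h2
      linarith
    have hn2 : d ≤ 2 * n := by
      have : (d : ℝ) ≤ 2 * n := by linarith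
      exact_mod_cast this
    have hk2 : 2 * k ≤ n := by
      have : 2 * (k : ℝ) ≤ n := by linarith
      exact_mod_cast this
    refine (abs_sum_level_le hc hB hn2 hnd hk2 ξ).trans ?_
    refine mul_le_mul_of_nonneg_left ?_ (Nat.cast_nonneg _)
    have hd0 : (0 : ℝ) < d := by linarith
    have hn0 : (0 : ℝ) < n := by linarith
    have hndR : (n : ℝ) ≤ d := by exact_mod_cast hnd
    -- `k > L / 80` and `n ≤ d`; the constant is `320 = 80 · 4`.
    have hcoef : c * (L / d) / 320 ≤ c * k / n / 4 := by
      have h1 : L / 80 / d ≤ k / n :=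
        div_le_div₀ (Nat.cast_nonneg _) (not_le.1 hxL).le hn0 hndR
      have h2 := mul_le_mul_of_nonneg_left h1 hc.1.le
      have e1 : c * (L / d) / 320 = c * (L / 80 / d) / 4 := by ring
      have e2 : c * k / n / 4 = c * (k / n) / 4 := by ring
      rw [e1, e2]
      linarith
    have hcoef0 : 0 ≤ c * (L / d) / 320 :=
      div_nonneg (mul_nonneg hc.1.le (div_nonneg (by linarith) hd0.le)) (by norm_num)
    have hexp : ∀ T, 0 ≤ T → min S S' ≤ T → Real.exp (-(c * k / n / 4 * T)) ≤ E := by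
      intro T hT hmin
      rw [hE, Real.exp_le_exp, neg_le_neg_iff]
      exact (mul_le_mul_of_nonneg_left hmin hcoef0).trans (mul_le_mul_of_nonneg_right hcoef hT)
    linarith [hexp S hS0 (min_le_left _ _), hexp S' hS'0 (min_le_right _ _)]
  rw [← Finset.sum_filter_add_sum_filter_not B fun x => ((ones x).card : ℝ) ≤ L / 80]
  have hcard : (B₂.card : ℝ) ≤ B.card := by exact_mod_cast Finset.card_filter_le _ _
  have hE0 : 0 ≤ 2 * E := by positivity
  calc _ ≤ |∑ x ∈ B₁, F x| + |∑ x ∈ B₂, F x| := abs_add_le _ _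
    _ ≤ 2 / L * B.card + B.card * (2 * E) :=
        add_le_add hbad (hgood.trans (mul_le_mul_of_nonneg_right hcard hE0))
    _ = _ := by ring

end Decay

/-! ### Translation to the multiplier and conclusion -/

section Assembly

theorem torusNorm_sq {d : ℕ} (ξ : Fin d → ℝ) :
    torusNorm ξ ^ 2 = ∑ j, Real.sin (Real.pi * ξ j) ^ 2 :=
  Real.sq_sqrt (Finset.sum_nonneg fun _ _ => sq_nonneg _)

theorem torusNorm_halfShift_sq {d : ℕ} (ξ : Fin d → ℝ) :
    torusNorm (halfShift ξ) ^ 2 = ∑ j, (1 - Real.sin (Real.pi * ξ j) ^ 2) := by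
  rw [torusNorm_sq]
  refine Finset.sum_congr rfl fun j _ => ?_
  rw [halfShift, mul_add, show Real.pi * (1 / 2) = Real.pi / 2 by ring, Real.sin_add_pi_div_two,
    Real.cos_sq']

theorem kappa_rpow {q : ℝ} (hq : 1 ≤ q) (d N : ℕ) : kappa q d N ^ q = (N : ℝ) ^ q / d := by
  rw [kappa, Real.div_rpow (Nat.cast_nonneg _) (by positivity), ← Real.rpow_mul (Nat.cast_nonneg _),
    one_div_mul_cancel (by linarith), Real.rpow_one]

theorem average_eq {q : ℝ} {d : ℕ} {t : ℝ} {B : Finset (Fin d → ℤ)}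
    (hB : ∀ x, x ∈ B ↔ x ∈ latticeBall q d t) (f : (Fin d → ℤ) → ℂ) :
    average q d t f = (1 / (B.card : ℂ)) * ∑ x ∈ B, f x := by
  have h : latticeBall q d t = (B : Set (Fin d → ℤ)) := Set.ext fun x => (hB x).symm
  rw [average, h, Set.ncard_coe_finset, finsum_mem_coe_finset]

theorem e_int_half (m : ℤ) : e ((m : ℝ) * (1 / 2)) = (-1 : ℂ) ^ m := by
  rw [e, ← Complex.exp_pi_mul_I, ← Complex.exp_int_mul]
  push_cast
  congr 1
  ring

theorem neg_one_zpow_sum_units_mul {d : ℕ} (ε : Fin d → ℤˣ) (x : Fin d → ℤ) :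
    (-1 : ℂ) ^ (∑ i, (ε i : ℤ) * x i) = (-1 : ℂ) ^ (∑ i, x i) := by
  have h : ∀ y : Fin d → ℤ, (-1 : ℂ) ^ (∑ i, y i) = ∏ i, (-1 : ℂ) ^ y i := by
    intro y
    rw [← e_int_half, Int.cast_sum, Finset.sum_mul, e_sum]
    exact Finset.prod_congr rfl fun i _ => e_int_half _
  rw [h, h]
  refine Finset.prod_congr rfl fun i _ => ?_
  rcases Int.units_eq_one_or (ε i) with hi | hi
  · simp [hi]
  · rw [hi]
    simp [← inv_zpow]

theorem norm_neg_one_zpow (m : ℤ) : ‖(-1 : ℂ) ^ m‖ = 1 := by simp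

theorem e_eq_neg_one_zpow_mul {d : ℕ} (x : Fin d → ℤ) (ξ : Fin d → ℝ) :
    e (∑ i, (x i : ℝ) * ξ i) = (-1 : ℂ) ^ (∑ i, x i) * e (∑ i, (x i : ℝ) * halfShift ξ i) := by
  have hadd : ∀ a b : ℝ, e (a + b) = e a * e b := by
    intro a b
    rw [e, e, e, ← Complex.exp_add]
    push_cast
    ring_nf
  have h : ∑ i, (x i : ℝ) * halfShift ξ i =
      ∑ i, (x i : ℝ) * ξ i + ((∑ i, x i : ℤ) : ℝ) * (1 / 2) := by
    rw [Int.cast_sum, Finset.sum_mul, ← Finset.sum_add_distrib]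
    exact Finset.sum_congr rfl fun i _ => by rw [halfShift]; ring
  rw [h, hadd, e_int_half, mul_left_comm, ← zpow_add₀ (by norm_num), ← two_mul, zpow_mul]
  norm_num

end Assembly

end LqBall

theorem proposition3p5 :
    (∃ c : ℝ, LqBall.IsKrawtchoukConstant c) ∧
    ∃ C : ℝ, 0 < C ∧
      ∀ (q : ℝ) (d N : ℕ), 1 ≤ q → 1 ≤ d → 1 ≤ N →
        LqBall.kappa q d N ≤ Real.exp (-12 / q) →
        ∀ ξ : Fin d → ℝ,
          (∀ c : ℝ, LqBall.IsKrawtchoukConstant c →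
            ‖LqBall.multiplier q d N ξ‖ ≤
              C * (Real.exp (-(c * LqBall.kappa q d N ^ q / 320 *
                    min (LqBall.torusNorm ξ ^ 2)
                      (LqBall.torusNorm (LqBall.halfShift ξ) ^ 2)))
                  + 1 / (N : ℝ) ^ q)) ∧
          (LqBall.torusNorm ξ ≤ LqBall.torusNorm (LqBall.halfShift ξ) →
            ‖LqBall.multiplier q d N ξ - 1‖ ≤
              C * (LqBall.kappa q d N ^ q * LqBall.torusNorm ξ ^ 2
                  + 1 / (N : ℝ) ^ q
                  + LqBall.kappa q d N ^ (q / 50))) ∧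
          (LqBall.torusNorm (LqBall.halfShift ξ) < LqBall.torusNorm ξ →
            ‖LqBall.multiplier q d N ξ - LqBall.signedAverage q d N‖ ≤
              C * (LqBall.kappa q d N ^ q * LqBall.torusNorm (LqBall.halfShift ξ) ^ 2
                  + 1 / (N : ℝ) ^ q
                  + LqBall.kappa q d N ^ (q / 50))) := by
  -- `64 = 2 · 32` comes from the second moment bound; it also dominates the constants needed for
  -- the decay estimate.
  refine ⟨⟨_, LqBall.isKrawtchoukConstant_one_div_sixteen⟩, 64, by norm_num, ?_⟩
  intro q d N hq hd hN hκ ξ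
  have hq0 : 0 < q := by linarith
  have hd0 : (0 : ℝ) < d := by exact_mod_cast hd
  have hκ0 : 0 ≤ LqBall.kappa q d N := by rw [LqBall.kappa]; positivity
  have hκq := LqBall.kappa_rpow hq d N
  set L : ℝ := (N : ℝ) ^ q with hLdef
  have hL1 : 1 ≤ L := Real.one_le_rpow (by exact_mod_cast hN) hq0.le
  have hLd : L ≤ Real.exp (-12) * d := by
    have h := Real.rpow_le_rpow hκ0 hκ hq0.le
    rwa [hκq, ← Real.exp_mul, div_mul_cancel₀ _ hq0.ne', div_le_iff₀ hd0] at h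
  have hexp12 : Real.exp (-12) ≤ 1 / 32 := by
    rw [Real.exp_neg, ← one_div]
    refine one_div_le_one_div_of_le (by norm_num) ?_
    nlinarith [Real.quadratic_le_exp_of_nonneg (x := 12) (by norm_num)]
  have hLd32 : 32 * L ≤ d := by nlinarith
  set B := (LqBall.latticeBall_finite hq d (Nat.cast_nonneg (α := ℝ) N)).toFinset with hBdef
  have hBmem : ∀ x, x ∈ B ↔ x ∈ LqBall.latticeBall q d N := fun x => Set.Finite.mem_toFinset _
  have hB : ∀ x, x ∈ B ↔ ∑ i, |(x i : ℝ)| ^ q ≤ L := hBmem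
  have hBpos : 0 < B.card := by
    refine Finset.card_pos.2 ⟨0, (hB 0).2 ?_⟩
    simp [Real.zero_rpow hq0.ne']
    linarith
  have hBR : (0 : ℝ) < B.card := by exact_mod_cast hBpos
  have hBC : (B.card : ℂ) ≠ 0 := by exact_mod_cast hBpos.ne'
  have hnorm : ∀ (z : ℂ) (b : ℝ), ‖z‖ ≤ B.card * b → ‖1 / (B.card : ℂ) * z‖ ≤ b := by
    intro z b hz
    rw [norm_mul, norm_div, norm_one, Complex.norm_natCast, one_div, inv_mul_le_iff₀ hBR]
    exact hz
  have hm : LqBall.multiplier q d N ξ = 1 / (B.card : ℂ) *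
      ∑ x ∈ B, (1 : ℂ) * ((∏ i, Real.cos (2 * Real.pi * (x i * ξ i)) : ℝ) : ℂ) := by
    rw [LqBall.multiplier, LqBall.average_eq hBmem,
      ← LqBall.sum_mul_e_eq_sum_mul_prod_cos hB (s := fun _ => 1) (fun _ _ => rfl)]
    simp only [one_mul]
  have herr : 0 ≤ 1 / L := by positivity
  have herr' : 0 ≤ LqBall.kappa q d N ^ (q / 50) := Real.rpow_nonneg hκ0 _
  refine ⟨fun c hc => ?_, fun _ => ?_, fun _ => ?_⟩
  · rw [hm, hκq, LqBall.torusNorm_sq, LqBall.torusNorm_halfShift_sq]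
    refine hnorm _ _ ?_
    simp only [one_mul]
    rw [← Complex.ofReal_sum, Complex.norm_real, Real.norm_eq_abs]
    rcases le_or_gt 20 L with hL | hL
    · refine (LqBall.abs_sum_prod_cos_le hc hq hB hL hLd (by linarith) ξ).trans ?_
      refine mul_le_mul_of_nonneg_left ?_ hBR.le
      rw [show (2 : ℝ) / L = 2 * (1 / L) by ring]
      linarith [Real.exp_pos (-(c * (L / d) / 320 * min (∑ i, Real.sin (Real.pi * ξ i) ^ 2)
        (∑ i, (1 - Real.sin (Real.pi * ξ i) ^ 2))))]
    -- For `L < 20` the trivial bound 1 suffices, since `64 / L > 1`.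
    · have htriv : |∑ x ∈ B, ∏ i, Real.cos (2 * Real.pi * (x i * ξ i))| ≤ B.card * 1 := by
        rw [← nsmul_eq_mul, ← Finset.sum_const]
        refine (Finset.abs_sum_le_sum_abs _ _).trans (Finset.sum_le_sum fun x _ => ?_)
        rw [Finset.abs_prod]
        exact Finset.prod_le_one (fun i _ => abs_nonneg _) fun i _ => Real.abs_cos_le_one _
      refine htriv.trans (mul_le_mul_of_nonneg_left ?_ hBR.le)
      have h1 : 1 / 20 ≤ 1 / L := one_div_le_one_div_of_le (by linarith) hL.le
      linarith [Real.exp_pos (-(c * (L / d) / 320 * min (∑ i, Real.sin (Real.pi * ξ i) ^ 2)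
        (∑ i, (1 - Real.sin (Real.pi * ξ i) ^ 2))))]
  · have h := LqBall.norm_sum_mul_prod_cos_sub_le hq hB hLd32 hd (s := fun _ => 1)
      (fun _ => norm_one) ξ
    have hone : (1 : ℂ) = 1 / (B.card : ℂ) * ∑ x ∈ B, (1 : ℂ) := by
      rw [Finset.sum_const, nsmul_eq_mul, mul_one, one_div_mul_cancel hBC]
    have h' := hnorm _ _ h
    -- The low-frequency bound has only the main term; the other two terms are nonnegative and are
    -- simply added.
    rw [mul_sub, ← hm, ← hone] at h'
    rw [hκq, LqBall.torusNorm_sq]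
    linarith
  · have h := LqBall.norm_sum_mul_prod_cos_sub_le hq hB hLd32 hd
      (s := fun x => (-1 : ℂ) ^ (∑ i, x i)) (fun _ => LqBall.norm_neg_one_zpow _)
      (LqBall.halfShift ξ)
    have hm' : LqBall.multiplier q d N ξ = 1 / (B.card : ℂ) *
        ∑ x ∈ B, (-1 : ℂ) ^ (∑ i, x i) *
          ((∏ i, Real.cos (2 * Real.pi * (x i * LqBall.halfShift ξ i)) : ℝ) : ℂ) := by
      rw [LqBall.multiplier, LqBall.average_eq hBmem,
        ← LqBall.sum_mul_e_eq_sum_mul_prod_cos hB LqBall.neg_one_zpow_sum_units_mul]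
      congr 1
      exact Finset.sum_congr rfl fun x _ => LqBall.e_eq_neg_one_zpow_mul x ξ
    have h' := hnorm _ _ h
    rw [mul_sub, ← hm'] at h'
    rw [LqBall.signedAverage, LqBall.average_eq hBmem, hκq, LqBall.torusNorm_sq]
    linarith
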